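/- Let $n\ge 3$ be an integer, $\alpha\in(0,n)$, and $p=2^*_\alpha:=\frac{n+\alpha}{n-2}$. Put $f(\xi)=|\xi|^{p-2}\xi$ and $F(\xi)=p|\xi|^p$ for $\xi\in\mathbb R$. Let $u\in C^2(\mathbb R^n\setminus\{0\})\cap L^{p}_{\rm loc}(\mathbb R^n)$ be positive on $\mathbb R^n\setminus\{0\}$ and singular at the origin, i.e. $\liminf_{x\to 0}u(x)=\infty$. Assume that $u$ is a classical solution of the critical Hartree equation $$-\Delta u(x)=\Big(\int_{\mathbb R^n}|x-y|^{\alpha-n}F(u(y))\,dy\Big)\,f(u(x)),\qquad x\in\mathbb R^n\setminus\{0\},$$ where the integral is convergent for every $x\neq0$. (The local integrability of $u^p$ on $\mathbb R^n$ and the convergence of the integral hold in particular whenever $u\in C^2(\mathbb R^n\setminus\{0\})\cap L^{p}(\mathbb R^n)$.) Then $u$ is radially symmetric about the origin and decreasing in the radial direction: there is a strictly decreasing function $w:(0,\infty)\to\mathbb R$ with $u(x)=w(|x|)$ for all $x\ne0$. -/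

import Mathlib

open MeasureTheory Filter Topology
open scoped Laplacian Convolution

noncomputable section

/-- The critical exponent `2^*_α = (n + α) / (n - 2)`. -/
def critExp (n : ℕ) (α : ℝ) : ℝ := ((n : ℝ) + α) / ((n : ℝ) - 2)

/-- The Riesz kernel `R_α(x) = |x|^(α - n)` on `ℝⁿ`. -/
def rieszKernel (n : ℕ) (α : ℝ) (x : EuclideanSpace ℝ (Fin n)) : ℝ :=
  ‖x‖ ^ (α - (n : ℝ))

/-- The nonlinearity `f(ξ) = |ξ|^(p - 2) ξ` with `p = 2^*_α`. -/
def hartreef (n : ℕ) (α : ℝ) (ξ : ℝ) : ℝ := |ξ| ^ (critExp n α - 2) * ξ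

/-- The nonlinearity `F(ξ) = p |ξ|^p` with `p = 2^*_α`. -/
def hartreeF (n : ℕ) (α : ℝ) (ξ : ℝ) : ℝ := critExp n α * |ξ| ^ critExp n α

/-- `u` is a classical solution of `-Δu = (R_α ∗ F(u)) f(u)` on `ℝⁿ ∖ {0}`: it is `C²` there, the
integral defining `R_α ∗ F(u)` converges at every point of `ℝⁿ ∖ {0}`, and the equation holds
pointwise.  The value of `u` at `0` plays no role. -/
structure IsHartreeSolution (n : ℕ) (α : ℝ) (u : EuclideanSpace ℝ (Fin n) → ℝ) : Prop where
  contDiffOn : ContDiffOn ℝ 2 u {0}ᶜ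
  convolutionExists : ∀ x : EuclideanSpace ℝ (Fin n), x ≠ 0 →
    ConvolutionExistsAt (rieszKernel n α) (fun y => hartreeF n α (u y)) x
      (ContinuousLinearMap.lsmul ℝ ℝ) volume
  equation : ∀ x : EuclideanSpace ℝ (Fin n), x ≠ 0 →
    -(Δ u) x =
      (rieszKernel n α ⋆ (fun y => hartreeF n α (u y))) x
        * hartreef n α (u x)

/-- `u` is singular at the origin: `liminf_{x → 0} u(x) = ∞`. -/
def IsSingularAtZero {n : ℕ} (u : EuclideanSpace ℝ (Fin n) → ℝ) : Prop :=
  liminf (fun x => (u x : EReal)) (𝓝[≠] (0 : EuclideanSpace ℝ (Fin n))) = ⊤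

/-- `u ∈ L^q_loc(ℝⁿ)`: `u` is in `L^q` of every ball, the origin included. -/
def MemLpLoc {n : ℕ} (u : EuclideanSpace ℝ (Fin n) → ℝ) (q : ℝ) : Prop :=
  ∀ R : ℝ, 0 < R → MemLp u (ENNReal.ofReal q)
    (volume.restrict (Metric.ball (0 : EuclideanSpace ℝ (Fin n)) R))

/-- Sanity check: the convergence of the convolution and the local integrability of `u` are
automatic for a function `u ∈ C(ℝⁿ ∖ {0}) ∩ L^{2^*_α}(ℝⁿ)`. -/
theorem convolutionExists_of_memLp (n : ℕ) (hn : 3 ≤ n) (α : ℝ) (hα0 : 0 < α) (hαn : α < (n : ℝ))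
    (u : EuclideanSpace ℝ (Fin n) → ℝ) (hu : ContinuousOn u {0}ᶜ)
    (hLp : MemLp u (ENNReal.ofReal (critExp n α)) volume) :
    MemLpLoc u (critExp n α) ∧ ∀ x : EuclideanSpace ℝ (Fin n), x ≠ 0 →
      ConvolutionExistsAt (rieszKernel n α) (fun y => hartreeF n α (u y)) x
        (ContinuousLinearMap.lsmul ℝ ℝ) volume := by
  have hn' : (3 : ℝ) ≤ n := by exact_mod_cast hn
  have hp : 0 < critExp n α := div_pos (by linarith) (by linarith)
  refine ⟨fun R _ => hLp.restrict _, fun x hx => ?_⟩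
  have hF : Integrable (fun y => hartreeF n α (u y)) volume := by
    have h := hLp.integrable_norm_rpow (by simpa using hp) (by simp)
    rw [ENNReal.toReal_ofReal hp.le] at h
    exact h.const_mul (critExp n α)
  have hG : Integrable (fun t => hartreeF n α (u (x - t))) volume := hF.comp_sub_left x
  have hkm : Measurable (rieszKernel n α) := by
    unfold rieszKernel; fun_prop
  have hr : 0 < ‖x‖ / 2 := by positivity
  set r := ‖x‖ / 2 with hrdef
  unfold ConvolutionExistsAt
  simp only [ContinuousLinearMap.lsmul_apply, smul_eq_mul]
  rw [← integrableOn_univ,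
    ← Set.union_compl_self (Metric.closedBall (0 : EuclideanSpace ℝ (Fin n)) r)]
  refine IntegrableOn.union ?_ ?_
  · have hk : IntegrableOn (rieszKernel n α) (Metric.closedBall 0 r) volume := by
      have : LocallyIntegrable (rieszKernel n α) volume := by
        refine locallyIntegrable_of_norm_le_rpow (μ := volume) (C := 1) (α := n - α) ?_ ?_
          (.of_forall fun t => ?_) hkm.aestronglyMeasurable
        · simp only [finrank_euclideanSpace_fin]; lia
        · simp only [finrank_euclideanSpace_fin]; linarith
        · unfold rieszKernel
          rw [Real.norm_of_nonneg (by positivity), neg_sub, one_mul]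
      exact this.integrableOn_isCompact (isCompact_closedBall _ _)
    have hc : ContinuousOn (fun t => hartreeF n α (u (x - t))) (Metric.closedBall 0 r) := by
      have h1 : ContinuousOn (fun t => u (x - t)) (Metric.closedBall 0 r) := by
        refine hu.comp (by fun_prop) ?_
        intro t ht h0
        have h2 : x = t := sub_eq_zero.mp h0
        have h3 : ‖t‖ ≤ r := by simpa using ht
        rw [← h2] at h3
        linarith
      unfold hartreeF
      exact continuousOn_const.mul (h1.abs.rpow_const (fun _ _ => Or.inr hp.le))
    exact hk.mul_continuousOn hc (isCompact_closedBall _ _)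
  · refine Integrable.bdd_mul (c := r ^ (α - n)) hG.integrableOn hkm.aestronglyMeasurable ?_
    refine (ae_restrict_iff' Metric.isClosed_closedBall.measurableSet.compl).2 (.of_forall ?_)
    intro t ht
    have h3 : r < ‖t‖ := by simpa using ht
    unfold rieszKernel
    rw [Real.norm_of_nonneg (by positivity)]
    exact Real.rpow_le_rpow_of_nonpos hr h3.le (by linarith)

end

/-! The proof uses moving spheres, restricted to spheres of centre `c` and radius `l < ‖c‖`, which
leave the singularity outside. The claim (`IsHartreeSolution.kelvinLE`) is that `u` dominates its
Kelvin transform `u_l` outside every such sphere. Letting these spheres flatten into hyperplanes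
gives `u z ≤ u y` whenever `‖y‖ < ‖z‖` (`le_of_norm_lt_of_kelvinLE`). By continuity this extends to
equal norms, so `u` is radial and nonincreasing; `Δ u < 0` excludes a flat annulus.

The claim is proved by continuous induction on `l` (`kelvinLE_of_continuation`). The nonlocal term
is handled pointwise: if `u ≥ u_l` outside the sphere, folding the Riesz potential onto the exterior
shows that the potential inherits the comparison (`lintegral_rpow_norm_inversion_le`). At the
critical exponent all conformal weights match, and `Δ u ≤ Δ u_l` follows.

The minimum principle then has to give a strict gap. Since `u` blows up at `0` while `u_l` stays
bounded there, `u - u_l` dominates `Γ - Γ_l`, where `Γ` is a fundamental solution with pole `0`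
(`exists_kelvin_sub_le`). This explicit barrier supplies a lower bound away from the sphere, uniform
up to infinity after weighting, and a positive derivative on the sphere in place of Hopf's lemma.
Together they let the radius grow (`exists_kelvinLE_of_gt`). The start is the same step at radius
`0`, where the transform vanishes. -/

/-! ### Second derivatives along lines and weak minimum principles. -/

section Laplacian

variable {E : Type*} [NormedAddCommGroup E] [InnerProductSpace ℝ E]

theorem hasDerivAt_quadratic (a b t : ℝ) :
    HasDerivAt (fun t : ℝ => a + b * t + t ^ 2) (b + 2 * t) t := by
  have := (((hasDerivAt_id t).const_mul b).const_add a).fun_add (hasDerivAt_pow 2 t)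
  simpa using this

theorem eventually_hasDerivAt_line {f : E → ℝ} {y : E} (hf : ContDiffAt ℝ 2 f y) (v : E) :
    ∀ᶠ t : ℝ in 𝓝 0, HasDerivAt (fun t : ℝ => f (y + t • v)) (fderiv ℝ f (y + t • v) v) t := by
  have h1 : ∀ᶠ z in 𝓝 y, ContDiffAt ℝ 2 f z := hf.eventually (by simp)
  have hc : Tendsto (fun t : ℝ => y + t • v) (𝓝 0) (𝓝 y) := by
    have : ContinuousAt (fun t : ℝ => y + t • v) 0 := by fun_prop
    simpa [ContinuousAt] using this
  filter_upwards [hc.eventually h1] with t ht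
  have hl : HasDerivAt (fun t : ℝ => y + t • v) v t := by
    simpa using ((hasDerivAt_id t).smul_const v).const_add y
  exact (ht.differentiableAt (by simp)).hasFDerivAt.comp_hasDerivAt t hl

theorem hasFDerivAt_fderiv_of_contDiffAt {f : E → ℝ} {y : E} (hf : ContDiffAt ℝ 2 f y) :
    HasFDerivAt (fderiv ℝ f) (fderiv ℝ (fderiv ℝ f) y) y :=
  ((hf.fderiv_right (m := 1) (by norm_num)).differentiableAt (by simp)).hasFDerivAt

theorem hasDerivAt_fderiv_line {f : E → ℝ} {y : E} (hf : ContDiffAt ℝ 2 f y) (v : E) :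
    HasDerivAt (fun t : ℝ => fderiv ℝ f (y + t • v) v) (fderiv ℝ (fderiv ℝ f) y v v) 0 := by
  have hl : HasDerivAt (fun t : ℝ => y + t • v) v 0 := by
    simpa using ((hasDerivAt_id (0 : ℝ)).smul_const v).const_add y
  have h2 : HasFDerivAt (fderiv ℝ f) (fderiv ℝ (fderiv ℝ f) y) (y + (0 : ℝ) • v) := by
    simpa using hasFDerivAt_fderiv_of_contDiffAt hf
  have h3 := h2.comp_hasDerivAt (0 : ℝ) hl
  simpa using h3.clm_apply (hasDerivAt_const (0 : ℝ) v)

theorem fderiv_fderiv_eq_of_hasDerivAt_line {f : E → ℝ} {y v : E} (hf : ContDiffAt ℝ 2 f y)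
    {g : ℝ → ℝ} {a : ℝ} (h1 : ∀ᶠ t : ℝ in 𝓝 0, HasDerivAt (fun t : ℝ => f (y + t • v)) (g t) t)
    (h2 : HasDerivAt g a 0) : fderiv ℝ (fderiv ℝ f) y v v = a := by
  have h3 : g =ᶠ[𝓝 0] fun t : ℝ => fderiv ℝ f (y + t • v) v := by
    filter_upwards [h1, eventually_hasDerivAt_line hf v] with t h h'
    exact h.unique h'
  exact ((hasDerivAt_fderiv_line hf v).congr_of_eventuallyEq h3).unique h2

/-- The second derivative of a function in a fixed direction is nonnegative at a local minimum. -/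
theorem fderiv_fderiv_nonneg_of_isLocalMin {f : E → ℝ} {y : E} (hf : ContDiffAt ℝ 2 f y)
    (hmin : IsLocalMin f y) (v : E) : 0 ≤ fderiv ℝ (fderiv ℝ f) y v v := by
  by_contra! hneg
  set g : ℝ → ℝ := fun t => f (y + t • v) with hg
  have hc : Tendsto (fun t : ℝ => y + t • v) (𝓝 0) (𝓝 y) := by
    have : ContinuousAt (fun t : ℝ => y + t • v) 0 := by fun_prop
    simpa [ContinuousAt] using this
  have hgmin : IsLocalMin g 0 := by
    filter_upwards [hc.eventually hmin] with t ht
    simpa [hg] using ht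
  have hd : deriv g =ᶠ[𝓝 0] fun t : ℝ => fderiv ℝ f (y + t • v) v := by
    filter_upwards [eventually_hasDerivAt_line hf v] with t ht
    exact ht.deriv
  have hdd : deriv (deriv g) 0 = fderiv ℝ (fderiv ℝ f) y v v := by
    rw [hd.deriv_eq]; exact (hasDerivAt_fderiv_line hf v).deriv
  have hgc : ContinuousAt g 0 := (eventually_hasDerivAt_line hf v).self_of_nhds.continuousAt
  -- A negative second derivative makes `0` a local maximum as well, so `g` is locally constant and
  -- its second derivative vanishes.
  have hmax : IsLocalMax g 0 :=
    isLocalMax_of_deriv_deriv_neg (by rw [hdd]; exact hneg) hgmin.deriv_eq_zero hgc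
  have hconst : g =ᶠ[𝓝 0] fun _ => g 0 := by
    filter_upwards [hgmin, hmax] with t h h'
    exact le_antisymm h' h
  have h0 : deriv (deriv g) 0 = 0 := by
    rw [hconst.deriv.deriv_eq]; simp
  linarith

variable [FiniteDimensional ℝ E]

theorem laplacian_eq_sum_fderiv_fderiv {ι : Type*} [Fintype ι] (b : OrthonormalBasis ι ℝ E)
    (f : E → ℝ) (y : E) : (Δ f) y = ∑ i, fderiv ℝ (fderiv ℝ f) y (b i) (b i) := by
  rw [InnerProductSpace.laplacian_eq_iteratedFDeriv_orthonormalBasis f b]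
  simp [iteratedFDeriv_two_apply]

theorem laplacian_nonneg_of_isLocalMin {f : E → ℝ} {y : E} (hf : ContDiffAt ℝ 2 f y)
    (hmin : IsLocalMin f y) : 0 ≤ (Δ f) y := by
  rw [laplacian_eq_sum_fderiv_fderiv (stdOrthonormalBasis ℝ E)]
  exact Finset.sum_nonneg fun i _ => fderiv_fderiv_nonneg_of_isLocalMin hf hmin _

theorem laplacian_norm_sq (y : E) :
    (Δ (fun z : E => ‖z‖ ^ 2)) y = 2 * (Module.finrank ℝ E : ℝ) := by
  rw [laplacian_eq_sum_fderiv_fderiv (stdOrthonormalBasis ℝ E)]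
  have h : ∀ i, fderiv ℝ (fderiv ℝ (fun z : E => ‖z‖ ^ 2)) y (stdOrthonormalBasis ℝ E i)
      (stdOrthonormalBasis ℝ E i) = 2 := by
    intro i
    have hi : ‖stdOrthonormalBasis ℝ E i‖ = 1 := (stdOrthonormalBasis ℝ E).orthonormal.1 i
    refine fderiv_fderiv_eq_of_hasDerivAt_line (contDiff_norm_sq ℝ).contDiffAt
      (g := fun t => 2 * inner ℝ y (stdOrthonormalBasis ℝ E i) + 2 * t) (.of_forall fun t => ?_) ?_
    · have : (fun t : ℝ => ‖y + t • stdOrthonormalBasis ℝ E i‖ ^ 2)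
          = fun t => ‖y‖ ^ 2 + 2 * inner ℝ y (stdOrthonormalBasis ℝ E i) * t + t ^ 2 := by
        funext t
        rw [norm_add_sq_real, norm_smul, hi, inner_smul_right]
        simp [sq_abs]; ring
      rw [this]
      exact hasDerivAt_quadratic _ _ t
    · simpa using ((hasDerivAt_id (0 : ℝ)).const_mul 2).const_add
        (2 * inner ℝ y (stdOrthonormalBasis ℝ E i))
  simp [h, mul_comm]

/-- Weak minimum principle on a compact set. -/
theorem IsCompact.superharmonic_ge [Nontrivial E] {K U : Set E} (hK : IsCompact K) (hU : IsOpen U)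
    (hUK : U ⊆ K) {f : E → ℝ} (hf : ContinuousOn f K) (hf2 : ∀ y ∈ U, ContDiffAt ℝ 2 f y)
    (hΔ : ∀ y ∈ U, (Δ f) y ≤ 0) {a : ℝ} (hb : ∀ y ∈ K \ U, a ≤ f y) :
    ∀ y ∈ K, a ≤ f y := by
  intro y hy
  obtain ⟨M, hM⟩ := hK.isBounded.exists_norm_le
  have hMy : 0 ≤ M := (norm_nonneg y).trans (hM y hy)
  refine le_of_forall_pos_sub_le fun ε hε => ?_
  -- Subtracting `κ ‖z‖ ^ 2` makes `f` strictly superharmonic, which rules out a minimum in `U`;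
  -- this `κ` keeps the error on `K` at most `ε`.
  set κ : ℝ := ε / (M ^ 2 + 1) with hκ
  have hκ0 : 0 < κ := by positivity
  set q : E → ℝ := fun z => -κ * ‖z‖ ^ 2 with hq
  have hqe : q = (-κ) • (fun z : E => ‖z‖ ^ 2) := by ext; simp [hq]
  have hq2 : ∀ z, ContDiffAt ℝ 2 q z := fun z =>
    contDiffAt_const.mul (contDiff_norm_sq ℝ).contDiffAt
  obtain ⟨z, hz, hzmin⟩ := hK.exists_isMinOn ⟨y, hy⟩
    (hf.add (fun z _ => (hq2 z).continuousAt.continuousWithinAt) : ContinuousOn (f + q) K)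
  have hzU : z ∉ U := by
    intro hzU
    have hloc : IsLocalMin (f + q) z := hzmin.isLocalMin (mem_of_superset (hU.mem_nhds hzU) hUK)
    have h1 := laplacian_nonneg_of_isLocalMin ((hf2 z hzU).add (hq2 z)) hloc
    change 0 ≤ (Δ (f + q)) z at h1
    rw [(hf2 z hzU).laplacian_add (hq2 z), hqe,
      InnerProductSpace.laplacian_smul _ (contDiff_norm_sq ℝ).contDiffAt, laplacian_norm_sq] at h1
    have h2 := hΔ z hzU
    have h3 : (0 : ℝ) < Module.finrank ℝ E := by exact_mod_cast Module.finrank_pos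
    have h4 : 0 < κ * (2 * (Module.finrank ℝ E : ℝ)) := by positivity
    simp only [smul_eq_mul] at h1
    linarith
  have h1 : (f + q) z ≤ (f + q) y := hzmin hy
  have h2 := hb z ⟨hz, hzU⟩
  have h3 : κ * ‖z‖ ^ 2 ≤ ε := by
    have h5 : ‖z‖ ^ 2 ≤ M ^ 2 := pow_le_pow_left₀ (norm_nonneg z) (hM z hz) 2
    calc κ * ‖z‖ ^ 2 ≤ κ * (M ^ 2 + 1) := by gcongr; linarith
      _ = ε := by rw [hκ]; field_simp
  have h4 : 0 ≤ κ * ‖y‖ ^ 2 := by positivity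
  simp only [Pi.add_apply, hq] at h1
  linarith

/-- Weak minimum principle on a closed set, for functions with nonnegative lower limit at
infinity. -/
theorem IsClosed.superharmonic_nonneg [Nontrivial E] {S U : Set E} (hS : IsClosed S) (hU : IsOpen U)
    (hUS : U ⊆ S) {f : E → ℝ} (hf : ContinuousOn f S) (hf2 : ∀ y ∈ U, ContDiffAt ℝ 2 f y)
    (hΔ : ∀ y ∈ U, (Δ f) y ≤ 0) (hb : ∀ y ∈ S \ U, 0 ≤ f y)
    (hinf : ∀ a > 0, ∃ R, ∀ y ∈ S, R ≤ ‖y‖ → -a ≤ f y) :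
    ∀ y ∈ S, 0 ≤ f y := by
  intro y hy
  refine le_of_forall_pos_sub_le fun a ha => ?_
  obtain ⟨R, hR⟩ := hinf a ha
  set R' := max R ‖y‖ + 1 with hR'
  have hyR : ‖y‖ < R' := by have := le_max_right R ‖y‖; linarith
  have key := IsCompact.superharmonic_ge (K := S ∩ Metric.closedBall 0 R')
    (U := U ∩ Metric.ball 0 R') ((isCompact_closedBall _ _).inter_left hS)
    (hU.inter Metric.isOpen_ball) (Set.inter_subset_inter hUS Metric.ball_subset_closedBall)
    (hf.mono Set.inter_subset_left) (fun z hz => hf2 z hz.1) (fun z hz => hΔ z hz.1) (a := -a) ?_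
    y ⟨hy, by simpa using hyR.le⟩
  · linarith
  · rintro z ⟨⟨hzS, hzR⟩, hzU⟩
    by_cases hz : z ∈ U
    · have : R' ≤ ‖z‖ := by
        by_contra! h
        exact hzU ⟨hz, by simpa using h⟩
      exact hR z hzS (by have := le_max_left R ‖y‖; linarith)
    · linarith [hb z ⟨hzS, hz⟩]

end Laplacian

/-! ### The Kelvin transform and its conformal covariance. -/

section Kelvin

open EuclideanGeometry

variable {E : Type*} [NormedAddCommGroup E] [InnerProductSpace ℝ E]

/-- The Kelvin transform of `f` with exponent `s` about the sphere of centre `c` and radius `r`. -/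
noncomputable def kelvin (s : ℝ) (c : E) (r : ℝ) (f : E → ℝ) (y : E) : ℝ :=
  (r / ‖y - c‖) ^ s * f (inversion c r y)

theorem kelvin_sub (s : ℝ) (c : E) (r : ℝ) (f g : E → ℝ) :
    kelvin s c r (f - g) = kelvin s c r f - kelvin s c r g := by
  ext y; simp [kelvin, mul_sub]

theorem kelvin_contDiffAt {s : ℝ} {c : E} {r : ℝ} (hr : 0 < r) {f : E → ℝ} {y : E} (hy : y ≠ c)
    (hf : ContDiffAt ℝ 2 f (inversion c r y)) : ContDiffAt ℝ 2 (kelvin s c r f) y := by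
  have h0 : y - c ≠ 0 := sub_ne_zero.2 hy
  have h1 : ContDiffAt ℝ 2 (fun z : E => ‖z - c‖) y :=
    (contDiffAt_id.sub contDiffAt_const).norm ℝ h0
  have h2 : ContDiffAt ℝ 2 (fun z : E => inversion c r z) y :=
    ContDiffAt.inversion (n := 2) contDiffAt_const contDiffAt_const contDiffAt_id hy
  have h3 : ContDiffAt ℝ 2 (fun z : E => r / ‖z - c‖) y :=
    contDiffAt_const.div h1 (norm_ne_zero_iff.2 h0)
  refine ContDiffAt.mul (h3.rpow_const_of_ne ?_) (hf.comp y h2)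
  have : 0 < ‖y - c‖ := norm_pos_iff.2 h0
  positivity

/-- Second derivative of `t ↦ b t * f (γ t)`. -/
theorem hasDerivAt_mul_comp_curve {f : E → ℝ} {b b₁ : ℝ → ℝ} {b₂ : ℝ} {γ γ₁ : ℝ → E} {γ₂ : E}
    (hf : ContDiffAt ℝ 2 f (γ 0)) (hb : ∀ᶠ t in 𝓝 0, HasDerivAt b (b₁ t) t)
    (hγ : ∀ᶠ t in 𝓝 0, HasDerivAt γ (γ₁ t) t) (hb₁ : HasDerivAt b₁ b₂ 0)
    (hγ₁ : HasDerivAt γ₁ γ₂ 0) :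
    ∃ g : ℝ → ℝ, (∀ᶠ t in 𝓝 0, HasDerivAt (fun t => b t * f (γ t)) (g t) t) ∧
      HasDerivAt g (b₂ * f (γ 0) + 2 * b₁ 0 * fderiv ℝ f (γ 0) (γ₁ 0)
        + b 0 * (fderiv ℝ (fderiv ℝ f) (γ 0) (γ₁ 0) (γ₁ 0) + fderiv ℝ f (γ 0) γ₂)) 0 := by
  have hγ0 := hγ.self_of_nhds
  have h1 : ∀ᶠ t in 𝓝 0, ContDiffAt ℝ 2 f (γ t) :=
    hγ0.continuousAt.tendsto.eventually (hf.eventually (by simp))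
  have hfγ : ∀ᶠ t in 𝓝 0, HasDerivAt (fun t => f (γ t)) (fderiv ℝ f (γ t) (γ₁ t)) t := by
    filter_upwards [h1, hγ] with t ht ht'
    exact (ht.differentiableAt (by simp)).hasFDerivAt.comp_hasDerivAt t ht'
  refine ⟨fun t => b₁ t * f (γ t) + b t * fderiv ℝ f (γ t) (γ₁ t), ?_, ?_⟩
  · filter_upwards [hfγ, hb] with t ht ht'
    exact ht'.mul ht
  · have h2 : HasDerivAt (fun t => fderiv ℝ f (γ t) (γ₁ t))
        (fderiv ℝ (fderiv ℝ f) (γ 0) (γ₁ 0) (γ₁ 0) + fderiv ℝ f (γ 0) γ₂) 0 :=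
      ((hasFDerivAt_fderiv_of_contDiffAt hf).comp_hasDerivAt (0 : ℝ) hγ0).clm_apply hγ₁
    refine ((hb₁.fun_mul hfγ.self_of_nhds).fun_add (hb.self_of_nhds.fun_mul h2)).congr_deriv ?_
    ring

theorem inversion_eq_smul (c : E) (r : ℝ) (y : E) :
    inversion c r y = c + (r ^ 2 * (‖y - c‖ ^ 2)⁻¹) • (y - c) := by
  rw [inversion, dist_eq_norm, vsub_eq_sub, vadd_eq_add, add_comm, div_pow, div_eq_mul_inv]

theorem kelvin_eq_norm_sq (s : ℝ) (c : E) {r : ℝ} (hr : 0 < r) (f : E → ℝ) (y : E) :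
    kelvin s c r f y = (r ^ s * (‖y - c‖ ^ 2) ^ (-s / 2)) *
      f (c + (r ^ 2 * (‖y - c‖ ^ 2)⁻¹) • (y - c)) := by
  rw [kelvin, inversion_eq_smul, Real.div_rpow hr.le (norm_nonneg _), ← Real.rpow_natCast_mul
    (norm_nonneg _)]
  congr 1
  rw [show ((2 : ℕ) : ℝ) * (-s / 2) = -s by push_cast; ring, Real.rpow_neg (norm_nonneg _),
    div_eq_mul_inv]

/-- Along the line `y + t • v` the squared distance to `c` is a monic quadratic `N t`, so the
transform is `b t * f (γ t)` with `b` and `γ` explicit in `N`. The vector fed to the derivatives of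
`f` is the reflection of `v` in the hyperplane orthogonal to `y - c`. -/
theorem fderiv_fderiv_kelvin {s : ℝ} {c : E} {r : ℝ} (hr : 0 < r) {f : E → ℝ} {y : E} (hy : y ≠ c)
    (hf : ContDiffAt ℝ 2 f (inversion c r y)) {v : E} (hv : ‖v‖ = 1) :
    fderiv ℝ (fderiv ℝ (kelvin s c r f)) y v v =
      (r / ‖y - c‖) ^ s *
        ((-s / ‖y - c‖ ^ 2 + s * (s + 2) * inner ℝ (y - c) v ^ 2 / ‖y - c‖ ^ 4)
            * f (inversion c r y)
          - 2 * s * inner ℝ (y - c) v / ‖y - c‖ ^ 2 * (r ^ 2 / ‖y - c‖ ^ 2) *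
              fderiv ℝ f (inversion c r y)
              (v - (2 * inner ℝ (y - c) v / ‖y - c‖ ^ 2) • (y - c))
          + (r ^ 2 / ‖y - c‖ ^ 2) ^ 2 * fderiv ℝ (fderiv ℝ f) (inversion c r y)
              (v - (2 * inner ℝ (y - c) v / ‖y - c‖ ^ 2) • (y - c))
              (v - (2 * inner ℝ (y - c) v / ‖y - c‖ ^ 2) • (y - c))
          + r ^ 2 / ‖y - c‖ ^ 2 * fderiv ℝ f (inversion c r y)
              ((-(4 * inner ℝ (y - c) v / ‖y - c‖ ^ 2)) • v
                + (8 * inner ℝ (y - c) v ^ 2 / ‖y - c‖ ^ 4 - 2 / ‖y - c‖ ^ 2) • (y - c))) := by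
  set x := y - c with hx
  set β : ℝ := inner ℝ x v with hβ
  have hx0 : x ≠ 0 := sub_ne_zero.2 hy
  have hxn : 0 < ‖x‖ := norm_pos_iff.2 hx0
  set N : ℝ → ℝ := fun t => ‖x‖ ^ 2 + 2 * β * t + t ^ 2 with hN
  have hNt : ∀ t, ‖x + t • v‖ ^ 2 = N t := by
    intro t
    rw [norm_add_sq_real, norm_smul, hv, inner_smul_right]
    simp [sq_abs, hN]; ring
  have hN0 : N 0 = ‖x‖ ^ 2 := by simp [hN]
  have hNd : ∀ t, HasDerivAt N (2 * β + 2 * t) t :=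
    hasDerivAt_quadratic _ _
  have hNpos : ∀ᶠ t in 𝓝 (0 : ℝ), 0 < N t :=
    (hNd 0).continuousAt.eventually_const_lt (by rw [hN0]; positivity)
  have hN0' : N 0 ≠ 0 := by rw [hN0]; positivity
  have hd2 : HasDerivAt (fun t : ℝ => 2 * β + 2 * t) 2 0 := by
    simpa using ((hasDerivAt_id (0 : ℝ)).const_mul 2).const_add (2 * β)
  have hxd : ∀ t : ℝ, HasDerivAt (fun t : ℝ => x + t • v) v t := fun t => by
    simpa using ((hasDerivAt_id t).smul_const v).const_add x
  set b : ℝ → ℝ := fun t => r ^ s * N t ^ (-s / 2) with hb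
  set b₁ : ℝ → ℝ := fun t => r ^ s * ((2 * β + 2 * t) * (-s / 2) * N t ^ (-s / 2 - 1)) with hb₁
  set γ : ℝ → E := fun t => c + (r ^ 2 * (N t)⁻¹) • (x + t • v) with hγ
  set γ₁ : ℝ → E := fun t => (r ^ 2 * (N t)⁻¹) • v +
    (r ^ 2 * (-(2 * β + 2 * t) / N t ^ 2)) • (x + t • v) with hγ₁
  have hbd : ∀ᶠ t in 𝓝 0, HasDerivAt b (b₁ t) t := by
    filter_upwards [hNpos] with t ht
    exact ((hNd t).rpow_const (Or.inl ht.ne')).const_mul _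
  have hγd : ∀ᶠ t in 𝓝 0, HasDerivAt γ (γ₁ t) t := by
    filter_upwards [hNpos] with t ht
    exact ((((hNd t).inv ht.ne').const_mul (r ^ 2)).smul (hxd t)).const_add c
  have hb0 : b 0 = (r / ‖x‖) ^ s := by
    simp only [hb, hN0]
    rw [Real.div_rpow hr.le (norm_nonneg _), ← Real.rpow_natCast_mul (norm_nonneg _),
      show ((2 : ℕ) : ℝ) * (-s / 2) = -s by push_cast; ring, Real.rpow_neg (norm_nonneg _),
      div_eq_mul_inv]
  have hpow1 : N 0 ^ (-s / 2 - 1) = N 0 ^ (-s / 2) / ‖x‖ ^ 2 := by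
    rw [Real.rpow_sub_one hN0', hN0]
  have hpow2 : N 0 ^ (-s / 2 - 1 - 1) = N 0 ^ (-s / 2) / ‖x‖ ^ 4 := by
    rw [Real.rpow_sub_one hN0', hpow1, hN0]; field_simp
  have hb₁0 : b₁ 0 = b 0 * (-s * β / ‖x‖ ^ 2) := by
    simp only [hb, hb₁, hpow1]; ring
  have hb₁d : HasDerivAt b₁ (b 0 * (-s / ‖x‖ ^ 2 + s * (s + 2) * β ^ 2 / ‖x‖ ^ 4)) 0 := by
    refine (((hd2.mul_const (-s / 2)).fun_mul
      ((hNd 0).rpow_const (p := -s / 2 - 1) (Or.inl hN0'))).const_mul (r ^ s)).congr_deriv ?_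
    simp only [hb, hpow1, hpow2]; ring
  have hγ₁0 : γ₁ 0 = (r ^ 2 / ‖x‖ ^ 2) • (v - (2 * β / ‖x‖ ^ 2) • x) := by
    simp only [hγ₁, hN0, zero_smul, add_zero, mul_zero]
    match_scalars <;> field_simp
  have hγ₁d : HasDerivAt γ₁ ((r ^ 2 / ‖x‖ ^ 2) • ((-(4 * β / ‖x‖ ^ 2)) • v
      + (8 * β ^ 2 / ‖x‖ ^ 4 - 2 / ‖x‖ ^ 2) • x)) 0 := by
    have hq : HasDerivAt (fun t => -(2 * β + 2 * t) / N t ^ 2)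
        (8 * β ^ 2 / ‖x‖ ^ 6 - 2 / ‖x‖ ^ 4) 0 := by
      refine (hd2.fun_neg.fun_div ((hNd 0).fun_pow 2) (pow_ne_zero 2 hN0')).congr_deriv ?_
      rw [hN0]; field_simp; push_cast; ring
    refine (((((hNd 0).fun_inv hN0').const_mul (r ^ 2)).smul_const v).fun_add
      ((hq.const_mul (r ^ 2)).fun_smul (hxd 0))).congr_deriv ?_
    simp only [hN0, zero_smul, add_zero, mul_zero]
    match_scalars <;> field_simp
    all_goals ring
  have hγ0 : γ 0 = inversion c r y := by
    rw [inversion_eq_smul]; simp [hγ, hN0, hx]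
  obtain ⟨g, hg1, hg2⟩ := hasDerivAt_mul_comp_curve (f := f) (b := b) (b₁ := b₁) (γ := γ)
    (γ₁ := γ₁) (by rw [hγ0]; exact hf) hbd hγd hb₁d hγ₁d
  have hkel : (fun t : ℝ => kelvin s c r f (y + t • v)) = fun t => b t * f (γ t) := by
    funext t
    rw [kelvin_eq_norm_sq s c hr, show y + t • v - c = x + t • v by rw [hx]; abel, hNt]
  rw [fderiv_fderiv_eq_of_hasDerivAt_line (kelvin_contDiffAt hr hy hf) (by rw [hkel]; exact hg1)
    hg2]
  rw [hγ0, ← hb0, hγ₁0, hb₁0]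
  simp only [map_smul, smul_apply, smul_eq_mul]
  ring

/-- The sign of the last product carries the geometry: for `y` and `z` both outside the sphere it is
positive. This yields the comparison of Riesz kernels and, with `z = 0`, the positivity of the
barrier. -/
theorem norm_inversion_sub_sq {c : E} {r : ℝ} {y : E} (hy : y ≠ c) (z : E) :
    ‖y - c‖ ^ 2 * ‖inversion c r y - z‖ ^ 2 =
      r ^ 2 * ‖y - z‖ ^ 2 + (‖y - c‖ ^ 2 - r ^ 2) * (‖z - c‖ ^ 2 - r ^ 2) := by
  have h0 : ‖y - c‖ ≠ 0 := norm_ne_zero_iff.2 (sub_ne_zero.2 hy)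
  rw [inversion_eq_smul, show c + (r ^ 2 * (‖y - c‖ ^ 2)⁻¹) • (y - c) - z =
    (r ^ 2 * (‖y - c‖ ^ 2)⁻¹) • (y - c) - (z - c) by abel,
    show y - z = (y - c) - (z - c) by abel]
  generalize y - c = x at h0 ⊢
  generalize z - c = w
  rw [norm_sub_sq_real, norm_sub_sq_real, norm_smul, real_inner_smul_left, Real.norm_eq_abs,
    mul_pow, sq_abs]
  field_simp
  ring

theorem norm_inversion_sub_center (c : E) (r : ℝ) (y : E) :
    ‖inversion c r y - c‖ = r ^ 2 / ‖y - c‖ := by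
  simpa [dist_eq_norm] using dist_inversion_center c y r

/-- The fundamental solution `y ↦ (r / ‖y‖) ^ (d - 2)`, as a Kelvin transform of `1`. -/
theorem kelvin_one_apply (s r : ℝ) (y : E) :
    kelvin s 0 r (fun _ => 1) y = (r / ‖y‖) ^ s := by simp [kelvin]

variable [FiniteDimensional ℝ E]

/-- The conformal covariance of the Laplacian under the Kelvin transform. -/
theorem laplacian_kelvin {s : ℝ} (hs : s = Module.finrank ℝ E - 2) {c : E} {r : ℝ} (hr : 0 < r)
    {f : E → ℝ} {y : E} (hy : y ≠ c) (hf : ContDiffAt ℝ 2 f (inversion c r y)) :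
    (Δ (kelvin s c r f)) y =
      (r / ‖y - c‖) ^ s * (r / ‖y - c‖) ^ 4 * (Δ f) (inversion c r y) := by
  set b := stdOrthonormalBasis ℝ E with hb
  set x := y - c with hx
  have hxn : ‖x‖ ≠ 0 := norm_ne_zero_iff.2 (sub_ne_zero.2 hy)
  set L := fderiv ℝ f (inversion c r y) with hL
  set Q := fderiv ℝ (fderiv ℝ f) (inversion c r y) with hQ
  have h1 : ∑ i, inner ℝ x (b i) ^ 2 = ‖x‖ ^ 2 := by
    simpa using b.sum_sq_norm_inner_left x
  have h2 : ∀ M : E →L[ℝ] ℝ, ∑ i, inner ℝ x (b i) * M (b i) = M x := by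
    intro M
    conv_rhs => rw [← b.sum_repr' x]
    simp [map_sum, real_inner_comm]
  have h3 : ∑ i, inner ℝ x (b i) * Q (b i) x = Q x x := h2 (Q.flip x)
  rw [laplacian_eq_sum_fderiv_fderiv b, laplacian_eq_sum_fderiv_fderiv b]
  have h4 : ∀ i, fderiv ℝ (fderiv ℝ (kelvin s c r f)) y (b i) (b i) =
      (r / ‖x‖) ^ s * ((-s / ‖x‖ ^ 2 * f (inversion c r y) - r ^ 2 / ‖x‖ ^ 2 * (2 / ‖x‖ ^ 2) * L x)
        + (s * (s + 2) / ‖x‖ ^ 4 * f (inversion c r y)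
            + 4 * (s + 2) * r ^ 2 / ‖x‖ ^ 6 * L x + (r ^ 2 / ‖x‖ ^ 2) ^ 2 * 4 / ‖x‖ ^ 4 * Q x x) *
            inner ℝ x (b i) ^ 2
        - (2 * (s + 2) * r ^ 2 / ‖x‖ ^ 4) * (inner ℝ x (b i) * L (b i))
        + (r ^ 2 / ‖x‖ ^ 2) ^ 2 * Q (b i) (b i)
        - (r ^ 2 / ‖x‖ ^ 2) ^ 2 * 2 / ‖x‖ ^ 2 * (inner ℝ x (b i) * Q (b i) x)
        - (r ^ 2 / ‖x‖ ^ 2) ^ 2 * 2 / ‖x‖ ^ 2 * (inner ℝ x (b i) * Q x (b i))) := by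
    intro i
    rw [fderiv_fderiv_kelvin hr hy hf (b.orthonormal.1 i)]
    simp only [← hL, ← hQ, ← hx, map_smul, map_add, map_sub, smul_apply, sub_apply, smul_eq_mul]
    field_simp
    ring
  simp only [h4, ← Finset.mul_sum, Finset.sum_sub_distrib, Finset.sum_add_distrib, h1, h2, h3,
    Finset.sum_const, Finset.card_univ, Fintype.card_fin, nsmul_eq_mul]
  -- With `s + 2` equal to the dimension, the terms in `f` and in `L x` cancel; those in `Q x x`
  -- cancel for every `s`. Only the trace of `Q` survives.
  rw [hs, div_pow r _ 4]
  field_simp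
  ring

theorem laplacian_kelvin_one {s : ℝ} (hs : s = Module.finrank ℝ E - 2) {r : ℝ} (hr : 0 < r)
    {y : E} (hy : y ≠ 0) : (Δ (kelvin s (0 : E) r (fun _ => 1))) y = 0 := by
  rw [laplacian_kelvin hs hr hy contDiffAt_const]
  simp

end Kelvin

/-! ### Comparison of Riesz potentials under inversion. -/

section RieszPotential

open EuclideanGeometry
open scoped ENNReal

variable {E : Type*} [NormedAddCommGroup E] [InnerProductSpace ℝ E] [FiniteDimensional ℝ E]

theorem abs_det_fderiv_inversion {c : E} {r : ℝ} {z : E} :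
    |((r / dist z c) ^ 2 • ((ℝ ∙ (z - c))ᗮ.reflection : E →L[ℝ] E)).det| =
      ((r / ‖z - c‖) ^ 2) ^ Module.finrank ℝ E := by
  rw [ContinuousLinearMap.det, ContinuousLinearMap.toLinearMap_smul, LinearMap.det_smul, abs_mul,
    abs_of_nonneg (by positivity), dist_eq_norm]
  have : |LinearMap.det (((ℝ ∙ (z - c))ᗮ.reflection : E →L[ℝ] E) : E →ₗ[ℝ] E)| = 1 := by
    have h := Submodule.det_reflection (ℝ ∙ (z - c))ᗮ
    erw [h]
    simp
  rw [this, mul_one]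

variable [MeasurableSpace E] [BorelSpace E] [Nontrivial E]

/-- Up to the sphere and its centre, which are null, the closed ball is the inverted exterior; the
second term is the change of variables. -/
theorem lintegral_eq_add_inversion (c : E) {r : ℝ} (hr : 0 < r) (g : E → ℝ≥0∞) :
    ∫⁻ z, g z = (∫⁻ z in {z | r < ‖z - c‖}, g z) +
      ∫⁻ z in {z | r < ‖z - c‖},
        ENNReal.ofReal (((r / ‖z - c‖) ^ 2) ^ Module.finrank ℝ E) * g (inversion c r z) := by
  set O : Set E := {z | r < ‖z - c‖} with hO
  have hOm : MeasurableSet O :=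
    (isOpen_lt continuous_const (continuous_id.sub continuous_const).norm).measurableSet
  have hne : ∀ z ∈ O, z ≠ c := by
    rintro z hz rfl
    simp [hO] at hz
    linarith
  have himg : (Oᶜ : Set E) =ᵐ[volume] inversion c r '' O := by
    have hnull : volume (Metric.sphere c r ∪ {c}) = 0 :=
      measure_union_null (Measure.addHaar_sphere _ _ _) (measure_singleton c)
    have hae : ∀ᵐ z, z ∉ Metric.sphere c r ∪ {c} := measure_eq_zero_iff_ae_notMem.1 hnull
    filter_upwards [hae] with z hz
    have hzc : z ≠ c := fun h => hz (Or.inr h)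
    have hzr : ‖z - c‖ ≠ r := fun h => hz (Or.inl (by simpa [dist_eq_norm] using h))
    have h0 : 0 < ‖z - c‖ := norm_pos_iff.2 (sub_ne_zero.2 hzc)
    refine propext ⟨fun h => ⟨inversion c r z, ?_, inversion_inversion c hr.ne' z⟩, ?_⟩
    · have h1 : ‖z - c‖ ≤ r := not_lt.1 h
      have h2 := lt_of_le_of_ne h1 hzr
      simp only [hO, Set.mem_ofPred_eq, norm_inversion_sub_center]
      rw [lt_div_iff₀ h0]; nlinarith
    · rintro ⟨w, hw, rfl⟩
      have hw' : r < ‖w - c‖ := hw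
      change ¬ (r < ‖inversion c r w - c‖)
      rw [norm_inversion_sub_center, not_lt, div_le_iff₀ (by linarith)]
      nlinarith
  rw [← lintegral_add_compl (μ := volume) g hOm, Measure.restrict_congr_set himg,
    lintegral_image_eq_lintegral_abs_det_fderiv_mul volume hOm
      (fun z hz => (hasFDerivAt_inversion (hne z hz)).hasFDerivWithinAt)
      (inversion_injective c hr.ne').injOn]
  simp only [abs_det_fderiv_inversion]

/-- If `F` dominates its reflection in the sphere of centre `c` and radius `r` outside that sphere,
then so does its Riesz potential. -/
theorem lintegral_rpow_norm_inversion_le {β : ℝ} (hβ : 0 ≤ β) {c : E} {r : ℝ} (hr : 0 < r)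
    {F : E → ℝ≥0∞} (hFm : AEMeasurable F volume)
    (hF : ∀ᵐ z, r < ‖z - c‖ → ENNReal.ofReal ((r / ‖z - c‖) ^ (2 * Module.finrank ℝ E - β)) *
      F (inversion c r z) ≤ F z) {y : E} (hy : r < ‖y - c‖) :
    ENNReal.ofReal ((r / ‖y - c‖) ^ β) *
        ∫⁻ z, ENNReal.ofReal (‖inversion c r y - z‖ ^ (-β)) * F z
      ≤ ∫⁻ z, ENNReal.ofReal (‖y - z‖ ^ (-β)) * F z := by
  set O : Set E := {z | r < ‖z - c‖} with hO
  have hOm : MeasurableSet O :=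
    (isOpen_lt continuous_const (continuous_id.sub continuous_const).norm).measurableSet
  have hya : 0 < ‖y - c‖ := hr.trans hy
  have hyc : y ≠ c := sub_ne_zero.1 (norm_pos_iff.1 hya)
  have hTyc : inversion c r y ≠ c := by rwa [Ne, inversion_eq_center hr.ne']
  set K₁ : E → ℝ≥0∞ := fun z => ENNReal.ofReal (‖y - z‖ ^ (-β)) with hK₁
  set K₂ : E → ℝ≥0∞ := fun z =>
    ENNReal.ofReal ((r / ‖y - c‖) ^ β * ‖inversion c r y - z‖ ^ (-β)) with hK₂
  -- The exponent collects the Jacobian, of weight twice the dimension, and the weight `-β` that the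
  -- kernel acquires under inversion.
  set G : E → ℝ≥0∞ := fun z =>
    ENNReal.ofReal ((r / ‖z - c‖) ^ (2 * Module.finrank ℝ E - β)) * F (inversion c r z) with hG
  have hJ : ∀ z ∈ O, ((r / ‖z - c‖) ^ 2) ^ Module.finrank ℝ E * (r / ‖z - c‖) ^ (-β) =
      (r / ‖z - c‖) ^ (2 * Module.finrank ℝ E - β) := by
    intro z hz
    have hz0 : 0 < r / ‖z - c‖ := div_pos hr (hr.trans hz)
    rw [← pow_mul, ← Real.rpow_natCast, ← Real.rpow_add hz0]
    push_cast; rfl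
  have hin : ∀ z ∈ O, ((r / ‖z - c‖) ^ 2) ^ Module.finrank ℝ E *
      ((r / ‖y - c‖) ^ β * ‖inversion c r y - inversion c r z‖ ^ (-β)) =
      ‖y - z‖ ^ (-β) * (r / ‖z - c‖) ^ (2 * Module.finrank ℝ E - β) := by
    intro z hz
    have hzb : 0 < ‖z - c‖ := hr.trans hz
    have hzc : z ≠ c := sub_ne_zero.1 (norm_pos_iff.1 hzb)
    have h1 : ‖inversion c r y - inversion c r z‖ = (r / ‖y - c‖) * ((r / ‖z - c‖) * ‖y - z‖) := by
      have := dist_inversion_inversion hyc hzc r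
      simp only [dist_eq_norm] at this
      rw [this]; field_simp
    rw [h1, Real.mul_rpow (by positivity) (by positivity), Real.mul_rpow (by positivity)
      (by positivity), ← hJ z hz]
    have h2 : (r / ‖y - c‖) ^ β * (r / ‖y - c‖) ^ (-β) = 1 := by
      rw [← Real.rpow_add (by positivity)]; simp
    linear_combination ((r / ‖z - c‖) ^ 2) ^ Module.finrank ℝ E * (r / ‖z - c‖) ^ (-β) *
      ‖y - z‖ ^ (-β) * h2
  have hout : ∀ z ∈ O, ((r / ‖z - c‖) ^ 2) ^ Module.finrank ℝ E *
      ‖y - inversion c r z‖ ^ (-β) =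
      (r / ‖y - c‖) ^ β * ‖inversion c r y - z‖ ^ (-β) *
        (r / ‖z - c‖) ^ (2 * Module.finrank ℝ E - β) := by
    intro z hz
    have hzb : 0 < ‖z - c‖ := hr.trans hz
    have hzc : z ≠ c := sub_ne_zero.1 (norm_pos_iff.1 hzb)
    have h1 : ‖y - inversion c r z‖ =
        (r / ‖y - c‖)⁻¹ * ((r / ‖z - c‖) * ‖inversion c r y - z‖) := by
      have := dist_inversion_inversion hTyc hzc r
      rw [inversion_inversion c hr.ne'] at this
      simp only [dist_eq_norm, norm_inversion_sub_center] at this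
      rw [this]; field_simp
    rw [h1, Real.mul_rpow (by positivity) (by positivity), Real.mul_rpow (by positivity)
      (by positivity), ← hJ z hz, Real.inv_rpow (by positivity), Real.rpow_neg (by positivity),
      inv_inv]
    ring
  have hK : ∀ z ∈ O, z ≠ y → K₂ z ≤ K₁ z := by
    intro z hz hzy
    refine ENNReal.ofReal_le_ofReal ?_
    have hzy0 : 0 < ‖y - z‖ := norm_pos_iff.2 (sub_ne_zero.2 hzy.symm)
    have h1 : ‖y - z‖ ≤ (r / ‖y - c‖)⁻¹ * ‖inversion c r y - z‖ := by
      have h2 := norm_inversion_sub_sq (r := r) hyc z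
      have hz' : r < ‖z - c‖ := hz
      have h3 : 0 ≤ (‖y - c‖ ^ 2 - r ^ 2) * (‖z - c‖ ^ 2 - r ^ 2) :=
        mul_nonneg (by nlinarith) (by nlinarith)
      have h4 : r * ‖y - z‖ ≤ ‖y - c‖ * ‖inversion c r y - z‖ := by
        refine le_of_sq_le_sq ?_ (by positivity)
        nlinarith
      rw [inv_div, div_mul_eq_mul_div, le_div_iff₀ hr]; linarith
    calc (r / ‖y - c‖) ^ β * ‖inversion c r y - z‖ ^ (-β)
        = ((r / ‖y - c‖)⁻¹ * ‖inversion c r y - z‖) ^ (-β) := by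
          rw [Real.mul_rpow (by positivity) (by positivity), Real.inv_rpow (by positivity),
            Real.rpow_neg (by positivity : (0 : ℝ) ≤ r / ‖y - c‖), inv_inv]
      _ ≤ ‖y - z‖ ^ (-β) := Real.rpow_le_rpow_of_nonpos hzy0 h1 (by linarith)
  have hK₁m : Measurable K₁ := by
    simp only [hK₁]; fun_prop
  -- This is `(K₁ - K₂) * (F - G) ≥ 0`, written without subtraction because the values may be
  -- infinite.
  have hpt : ∀ᵐ z, z ∈ O → K₂ z * F z + K₁ z * G z ≤ K₁ z * F z + K₂ z * G z := by
    have hae : ∀ᵐ z : E, z ≠ y := by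
      simp [ae_iff]
    filter_upwards [hae, hF] with z hzy hFz hz
    obtain ⟨D, hD⟩ := exists_add_of_le (hFz hz)
    obtain ⟨D', hD'⟩ := exists_add_of_le (hK z hz hzy)
    have hD1 : F z = G z + D := hD
    rw [hD1, hD']
    calc K₂ z * (G z + D) + (K₂ z + D') * G z
        ≤ K₂ z * (G z + D) + (K₂ z + D') * G z + D' * D := le_self_add
      _ = (K₂ z + D') * (G z + D) + K₂ z * G z := by ring
  calc ENNReal.ofReal ((r / ‖y - c‖) ^ β) *
        ∫⁻ z, ENNReal.ofReal (‖inversion c r y - z‖ ^ (-β)) * F z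
      = ∫⁻ z, K₂ z * F z := by
        rw [← lintegral_const_mul' _ _ ENNReal.ofReal_ne_top]
        congr 1; ext z
        simp only [hK₂]
        rw [ENNReal.ofReal_mul (by positivity), mul_assoc]
    _ = (∫⁻ z in O, K₂ z * F z) + ∫⁻ z in O, K₁ z * G z := by
        rw [lintegral_eq_add_inversion c hr]
        congr 1
        refine setLIntegral_congr_fun hOm fun z hz => ?_
        simp only [hK₁, hK₂, hG]
        rw [← mul_assoc, ← mul_assoc, ← ENNReal.ofReal_mul (by positivity),
          ← ENNReal.ofReal_mul (by positivity), hin z hz]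
    -- Superadditivity suffices here, so no measurability of `G` is needed.
    _ ≤ ∫⁻ z in O, (K₂ z * F z + K₁ z * G z) := le_lintegral_add _ _
    _ ≤ ∫⁻ z in O, (K₁ z * F z + K₂ z * G z) :=
        lintegral_mono_ae ((ae_restrict_iff' hOm).2 hpt)
    _ = (∫⁻ z in O, K₁ z * F z) + ∫⁻ z in O, K₂ z * G z :=
        lintegral_add_left' (hK₁m.aemeasurable.mul hFm.restrict) _
    _ = ∫⁻ z, K₁ z * F z := by
        rw [lintegral_eq_add_inversion c hr (fun z => K₁ z * F z)]
        congr 1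
        refine setLIntegral_congr_fun hOm fun z hz => ?_
        simp only [hK₁, hK₂, hG]
        rw [← mul_assoc, ← mul_assoc, ← ENNReal.ofReal_mul (by positivity),
          ← ENNReal.ofReal_mul (by positivity), hout z hz]

end RieszPotential

/-! ### Continuation in the radius, and monotonicity in the limit of large spheres. -/

section MovingSpheres

open EuclideanGeometry

variable {E : Type*} [NormedAddCommGroup E] [InnerProductSpace ℝ E]

/-- Outside the sphere of centre `c` and radius `r`, `u` dominates its Kelvin transform. -/
def KelvinLE (s : ℝ) (c : E) (u : E → ℝ) (r : ℝ) : Prop :=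
  ∀ y : E, y ≠ 0 → r ≤ ‖y - c‖ → kelvin s c r u y ≤ u y

theorem add_smul_ne_zero {c θ : E} {r : ℝ} (h : ‖r • θ‖ < ‖c‖) : c + r • θ ≠ 0 := by
  intro h0
  rw [eq_neg_of_add_eq_zero_left h0, norm_neg] at h
  exact lt_irrefl _ h

theorem hasDerivAt_rpow_mul_ray {s : ℝ} {c θ : E} {u : E → ℝ} {r : ℝ} (hr : 0 < r)
    (hu : DifferentiableAt ℝ u (c + r • θ)) :
    HasDerivAt (fun r : ℝ => r ^ (s / 2) * u (c + r • θ))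
      (r ^ (s / 2 - 1) * (s / 2 * u (c + r • θ) + r * fderiv ℝ u (c + r • θ) θ)) r := by
  have hl : HasDerivAt (fun t : ℝ => c + t • θ) θ r := by
    simpa using ((hasDerivAt_id r).smul_const θ).const_add c
  refine ((Real.hasDerivAt_rpow_const (p := s / 2) (Or.inl hr.ne')).fun_mul
    (hu.hasFDerivAt.comp_hasDerivAt r hl)).congr_deriv ?_
  have h1 : r ^ (s / 2) = r ^ (s / 2 - 1) * r := by
    rw [← Real.rpow_add_one hr.ne', sub_add_cancel]
  simp only [Function.comp_apply]
  rw [h1]; ring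

theorem strictMonoOn_rpow_mul_ray {s : ℝ} {c θ : E} {u : E → ℝ} {a b : ℝ}
    (ha : 0 ≤ a) (hu : ∀ r ∈ Set.Ioo a b, DifferentiableAt ℝ u (c + r • θ))
    (hpos : ∀ r ∈ Set.Ioo a b, 0 < s / 2 * u (c + r • θ) + r * fderiv ℝ u (c + r • θ) θ) :
    StrictMonoOn (fun r : ℝ => r ^ (s / 2) * u (c + r • θ)) (Set.Ioo a b) := by
  have hd := fun r (hr : r ∈ Set.Ioo a b) =>
    hasDerivAt_rpow_mul_ray (s := s) (ha.trans_lt hr.1) (hu r hr)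
  refine strictMonoOn_of_deriv_pos (convex_Ioo a b)
    (fun r hr => (hd r hr).continuousAt.continuousWithinAt) fun r hr => ?_
  rw [interior_Ioo] at hr
  rw [(hd r hr).deriv]
  exact mul_pos (Real.rpow_pos_of_pos (ha.trans_lt hr.1) _) (hpos r hr)

/-- The Kelvin weight splits between the two points. With `Φ t = t ^ (s / 2) * u (c + t • θ)` the
comparison reads `Φ (r ^ 2 / t) ≤ Φ t`, so near the sphere it follows once `Φ` is increasing. -/
theorem kelvin_le_iff_ray {s : ℝ} {c : E} {u : E → ℝ} {r : ℝ} (hr : 0 < r) {y : E} (hy : y ≠ c) :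
    kelvin s c r u y ≤ u y ↔
      (r ^ 2 / ‖y - c‖) ^ (s / 2) * u (c + (r ^ 2 / ‖y - c‖) • (‖y - c‖⁻¹ • (y - c))) ≤
        ‖y - c‖ ^ (s / 2) * u (c + ‖y - c‖ • (‖y - c‖⁻¹ • (y - c))) := by
  have h0 : 0 < ‖y - c‖ := norm_pos_iff.2 (sub_ne_zero.2 hy)
  have h1 : (r / ‖y - c‖) ^ s = (r ^ 2 / ‖y - c‖) ^ (s / 2) / ‖y - c‖ ^ (s / 2) := by
    rw [← Real.div_rpow (by positivity) h0.le, div_div, ← sq, ← div_pow,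
      ← Real.rpow_natCast_mul (by positivity)]
    congr 1; push_cast; ring
  have h2 : c + (r ^ 2 / ‖y - c‖) • (‖y - c‖⁻¹ • (y - c)) = inversion c r y := by
    rw [inversion_eq_smul, smul_smul]; congr 2; field_simp
  have h3 : c + ‖y - c‖ • (‖y - c‖⁻¹ • (y - c)) = y := by
    rw [smul_smul, mul_inv_cancel₀ h0.ne', one_smul]; abel
  rw [h2, h3, kelvin, h1, div_mul_eq_mul_div, div_le_iff₀ (by positivity), mul_comm (u y)]

/-- In the variable `ζ = (y - c) / ‖y - c‖ ^ 2` infinity becomes `ζ = 0`, so uniformity over an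
unbounded exterior reduces to compactness of a ball. -/
theorem kelvin_eq_inverted (s : ℝ) (c : E) {r : ℝ} (hr : 0 ≤ r) (u : E → ℝ) {y : E} (hy : y ≠ c) :
    ‖y - c‖ ^ s * kelvin s c r u y = r ^ s * u (c + r ^ 2 • ((‖y - c‖ ^ 2)⁻¹ • (y - c))) := by
  have h0 : 0 < ‖y - c‖ := norm_pos_iff.2 (sub_ne_zero.2 hy)
  rw [kelvin, inversion_eq_smul, smul_smul, Real.div_rpow hr h0.le]
  field_simp

variable [FiniteDimensional ℝ E]

/-- The continuation step of the method of moving spheres. -/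
theorem exists_kelvinLE_of_gt {s : ℝ} (hs : 0 < s) {c : E} {u : E → ℝ}
    (hu : ∀ y : E, y ≠ 0 → ContDiffAt ℝ 2 u y) {l : ℝ} (hl0 : 0 ≤ l) (hlc : l < ‖c‖)
    (hfar : ∀ η > 0, ∃ m > 0, ∀ y : E, y ≠ 0 → l + η ≤ ‖y - c‖ →
      m ≤ ‖y - c‖ ^ s * (u y - kelvin s c l u y))
    (hnear : ∀ θ : E, ‖θ‖ = 1 → 0 < s / 2 * u (c + l • θ) + l * fderiv ℝ u (c + l • θ) θ) :
    ∃ ε > 0, ∀ r, l < r → r < l + ε → KelvinLE s c u r := by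
  have hP : ∀ᶠ r in 𝓝 l, r < ‖c‖ ∧ ∀ θ ∈ Metric.sphere (0 : E) 1,
      0 < s / 2 * u (c + r • θ) + r * fderiv ℝ u (c + r • θ) θ := by
    refine (eventually_lt_nhds hlc).and
      ((isCompact_sphere (0 : E) 1).eventually_forall_of_forall_eventually fun θ hθ => ?_)
    have hθ1 : ‖θ‖ = 1 := by simpa using hθ
    have hne : c + l • θ ≠ 0 :=
      add_smul_ne_zero (by rwa [norm_smul, hθ1, mul_one, Real.norm_of_nonneg hl0])
    have hm : ContinuousAt (fun p : ℝ × E => c + p.1 • p.2) (l, θ) := by fun_prop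
    have h1 : ContinuousAt (fun p : ℝ × E => u (c + p.1 • p.2)) (l, θ) :=
      ContinuousAt.comp' (f := fun p : ℝ × E => c + p.1 • p.2) (hu _ hne).continuousAt hm
    have h2 : ContinuousAt (fun p : ℝ × E => fderiv ℝ u (c + p.1 • p.2)) (l, θ) :=
      ContinuousAt.comp' (f := fun p : ℝ × E => c + p.1 • p.2)
        (hasFDerivAt_fderiv_of_contDiffAt (hu _ hne)).continuousAt hm
    have h3 : ContinuousAt (fun p : ℝ × E => s / 2 * u (c + p.1 • p.2)
        + p.1 * fderiv ℝ u (c + p.1 • p.2) p.2) (l, θ) :=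
      (continuousAt_const.mul h1).add (continuousAt_fst.mul (h2.clm_apply continuousAt_snd))
    exact h3.eventually_const_lt (hnear θ hθ1)
  obtain ⟨η, hη, hηP⟩ := Metric.eventually_nhds_iff.1 hP
  obtain ⟨m, hm, hmf⟩ := hfar η hη
  have hG : ∀ᶠ r in 𝓝 l, ∀ ζ ∈ Metric.closedBall (0 : E) (1 / (l + η)),
      r ^ s * u (c + r ^ 2 • ζ) < l ^ s * u (c + l ^ 2 • ζ) + m := by
    refine (isCompact_closedBall (0 : E) _).eventually_forall_of_forall_eventually fun ζ hζ => ?_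
    have hζ1 : ‖ζ‖ ≤ 1 / (l + η) := by simpa using hζ
    have hlz : ‖l ^ 2 • ζ‖ < ‖c‖ := by
      rw [norm_smul, Real.norm_of_nonneg (by positivity)]
      calc l ^ 2 * ‖ζ‖ ≤ l ^ 2 * (1 / (l + η)) := by gcongr
        _ ≤ l := by
          rw [mul_one_div, div_le_iff₀ (by positivity)]; nlinarith
        _ < ‖c‖ := hlc
    have hne : c + l ^ 2 • ζ ≠ 0 := add_smul_ne_zero hlz
    have hm1 : ContinuousAt (fun p : ℝ × E => c + p.1 ^ 2 • p.2) (l, ζ) := by fun_prop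
    have hm2 : ContinuousAt (fun p : ℝ × E => c + l ^ 2 • p.2) (l, ζ) := by fun_prop
    have h1 : ContinuousAt (fun p : ℝ × E => u (c + p.1 ^ 2 • p.2)) (l, ζ) :=
      ContinuousAt.comp' (f := fun p : ℝ × E => c + p.1 ^ 2 • p.2) (hu _ hne).continuousAt hm1
    have h2 : ContinuousAt (fun p : ℝ × E => u (c + l ^ 2 • p.2)) (l, ζ) :=
      ContinuousAt.comp' (f := fun p : ℝ × E => c + l ^ 2 • p.2) (hu _ hne).continuousAt hm2
    have h3 : ContinuousAt (fun p : ℝ × E => p.1 ^ s) (l, ζ) :=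
      continuousAt_fst.rpow_const (Or.inr hs.le)
    exact (h3.mul h1).eventually_lt ((continuousAt_const.mul h2).add continuousAt_const)
      (by simpa using hm)
  obtain ⟨ε, hε, hεG⟩ := Metric.eventually_nhds_iff.1 hG
  refine ⟨min η ε, lt_min hη hε, fun r hlr hr y hy hry => ?_⟩
  have hr0 : 0 < r := hl0.trans_lt hlr
  have hρ : 0 < ‖y - c‖ := hr0.trans_le hry
  have hyc : y ≠ c := sub_ne_zero.1 (norm_pos_iff.1 hρ)
  -- In the shell near the sphere radial monotonicity decides; beyond it, the margin `m` absorbs the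
  -- change of radius from `l` to `r`.
  rcases lt_or_ge ‖y - c‖ (l + η) with hlt | hge
  · rw [kelvin_le_iff_ray hr0 hyc]
    set θ := ‖y - c‖⁻¹ • (y - c) with hθ
    have hθ1 : ‖θ‖ = 1 := by
      rw [hθ, norm_smul, norm_inv, norm_norm, inv_mul_cancel₀ hρ.ne']
    have hin : ∀ t ∈ Set.Ioo (max 0 (l - η)) (l + η), dist t l < η := by
      intro t ht
      have := (le_max_right 0 (l - η)).trans_lt ht.1
      rw [Real.dist_eq, abs_lt]
      exact ⟨by linarith, by linarith [ht.2]⟩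
    have hmono := strictMonoOn_rpow_mul_ray (s := s) (c := c) (θ := θ) (u := u)
      -- The truncation at `0` keeps the weight regular and covers `l = 0`.
      (a := max 0 (l - η)) (b := l + η) (le_max_left _ _)
      (fun t ht => (hu _ (add_smul_ne_zero (by
        have := (le_max_left 0 (l - η)).trans_lt ht.1
        rw [norm_smul, hθ1, mul_one, Real.norm_of_nonneg this.le]
        exact (hηP (hin t ht)).1))).differentiableAt (by simp))
      (fun t ht => (hηP (hin t ht)).2 θ (by simpa using hθ1))
    have h1 : r ^ 2 / ‖y - c‖ ≤ ‖y - c‖ := by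
      rw [div_le_iff₀ hρ]; nlinarith
    have h2 : max 0 (l - η) < r ^ 2 / ‖y - c‖ := by
      refine max_lt (by positivity) ?_
      rw [lt_div_iff₀ hρ]
      rcases le_or_gt l η with h | h
      · nlinarith
      · nlinarith
    exact hmono.monotoneOn ⟨h2, h1.trans_lt hlt⟩ ⟨h2.trans_le h1, hlt⟩ h1
  · have h1 := hmf y hy hge
    have h2 := hεG (y := r) (by
      rw [Real.dist_eq, abs_of_pos (by linarith)]
      have := min_le_right η ε
      linarith) ((‖y - c‖ ^ 2)⁻¹ • (y - c)) (by
        rw [mem_closedBall_zero_iff, norm_smul, norm_inv, norm_pow, norm_norm, one_div,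
          show (‖y - c‖ ^ 2)⁻¹ * ‖y - c‖ = ‖y - c‖⁻¹ by field_simp]
        exact inv_anti₀ (by positivity) hge)
    rw [← kelvin_eq_inverted s c hr0.le u hyc, ← kelvin_eq_inverted s c hl0 u hyc] at h2
    have hρs : 0 < ‖y - c‖ ^ s := by positivity
    refine le_of_mul_le_mul_left ?_ hρs
    linarith

omit [FiniteDimensional ℝ E] in
theorem KelvinLE.of_forall_lt {s : ℝ} (hs : 0 < s) {c : E} {u : E → ℝ}
    (hu : ∀ y : E, y ≠ 0 → ContinuousAt u y) {l : ℝ} (hl0 : 0 < l) (hlc : l < ‖c‖)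
    (h : ∀ r, 0 < r → r < l → KelvinLE s c u r) : KelvinLE s c u l := by
  intro y hy hly
  have hρ : 0 < ‖y - c‖ := hl0.trans_le hly
  have hT : inversion c l y ≠ 0 := by
    intro h0
    have h1 := norm_inversion_sub_center c l y
    rw [h0, zero_sub, norm_neg] at h1
    have : l ^ 2 / ‖y - c‖ ≤ l := by rw [div_le_iff₀ hρ]; nlinarith
    linarith
  have h1 : ContinuousAt (fun r : ℝ => inversion c r y) l := by
    simp only [inversion_eq_smul]; fun_prop
  have h2 : ContinuousAt (fun r : ℝ => kelvin s c r u y) l :=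
    ((continuousAt_id.div_const _).rpow_const (Or.inr hs.le)).mul
      (ContinuousAt.comp' (f := fun r : ℝ => inversion c r y) (hu _ hT) h1)
  refine le_of_tendsto (h2.tendsto.mono_left nhdsWithin_le_nhds : Tendsto _ (𝓝[<] l) _) ?_
  filter_upwards [Ioo_mem_nhdsLT hl0] with r hr
  exact h r hr.1 hr.2 y hy (hr.2.le.trans hly)

omit [FiniteDimensional ℝ E] in
/-- Continuous induction on the radius. -/
theorem kelvinLE_of_continuation {s : ℝ} (hs : 0 < s) {c : E} {u : E → ℝ}
    (hu : ∀ y : E, y ≠ 0 → ContinuousAt u y)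
    (hstart : ∃ ε > 0, ∀ r, 0 < r → r < ε → KelvinLE s c u r)
    (hstep : ∀ l, 0 < l → l < ‖c‖ → KelvinLE s c u l →
      ∃ ε > 0, ∀ r, l < r → r < l + ε → KelvinLE s c u r) :
    ∀ l, 0 < l → l < ‖c‖ → KelvinLE s c u l := by
  by_contra! hcon
  obtain ⟨l, hl0, hlc, hl⟩ := hcon
  set A : Set ℝ := {r | 0 < r ∧ ¬ KelvinLE s c u r} with hA
  have hne : A.Nonempty := ⟨l, hl0, hl⟩
  obtain ⟨ε, hε, hεr⟩ := hstart
  have hlow : ∀ r ∈ A, ε ≤ r := fun r hr => by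
    by_contra! h
    exact hr.2 (hεr r hr.1 h)
  have hbdd : BddBelow A := ⟨ε, hlow⟩
  have hI0 : 0 < sInf A := hε.trans_le (le_csInf hne hlow)
  have hIl : sInf A < ‖c‖ := (csInf_le hbdd ⟨hl0, hl⟩).trans_lt hlc
  have hlt : ∀ r, 0 < r → r < sInf A → KelvinLE s c u r := fun r hr0 hr => by
    by_contra h
    exact notMem_of_lt_csInf hr hbdd ⟨hr0, h⟩
  have hI := KelvinLE.of_forall_lt hs hu hI0 hIl hlt
  obtain ⟨ε', hε', hstep'⟩ := hstep _ hI0 hIl hI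
  obtain ⟨r, hrA, hr⟩ := exists_lt_of_csInf_lt hne (by linarith : sInf A < sInf A + ε')
  rcases (csInf_le hbdd hrA).lt_or_eq with h | h
  · exact hrA.2 (hstep' r h hr)
  · exact hrA.2 (h ▸ hI)

omit [FiniteDimensional ℝ E] in
/-- A function that dominates its Kelvin transforms in all spheres that do not enclose the origin
is radially nonincreasing. -/
theorem le_of_norm_lt_of_kelvinLE {s : ℝ} {u : E → ℝ}
    (h : ∀ c : E, ∀ l, 0 < l → l < ‖c‖ → KelvinLE s c u l) {y z : E} (hy : y ≠ 0)
    (hyz : ‖y‖ < ‖z‖) : u z ≤ u y := by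
  have hzy : 0 < ‖z - y‖ := norm_pos_iff.2 (sub_ne_zero.2 fun h => by simp [h] at hyz)
  have key : ∀ t : ℝ, 0 < t → (t / (t + 1)) ^ (s / 2) * u z ≤ u y := by
    intro t ht
    -- The centre lies beyond `z` on the ray from `y`, and `l` is the geometric mean of its
    -- distances to `z` and `y`, so inversion exchanges the two points. The condition `‖y‖ < ‖z‖`
    -- gives `l < ‖c‖`. As `t → ∞` the Kelvin weight tends to `1`.
    set c := z + t • (z - y) with hc
    set l := √(t * (t + 1)) * ‖z - y‖ with hl
    have hl0 : 0 < l := by positivity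
    have hl2 : l ^ 2 = t * (t + 1) * ‖z - y‖ ^ 2 := by
      rw [hl, mul_pow, Real.sq_sqrt (by positivity)]
    have hyc : y - c = -((t + 1) • (z - y)) := by rw [hc]; module
    have hycn : ‖y - c‖ = (t + 1) * ‖z - y‖ := by
      rw [hyc, norm_neg, norm_smul, Real.norm_of_nonneg (by positivity)]
    have hlc : l < ‖c‖ := by
      refine lt_of_pow_lt_pow_left₀ 2 (norm_nonneg _) ?_
      have h1 : ‖c‖ ^ 2 = ‖z‖ ^ 2 + t * (‖z‖ ^ 2 + ‖z - y‖ ^ 2 - ‖y‖ ^ 2)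
          + t ^ 2 * ‖z - y‖ ^ 2 := by
        rw [hc, norm_add_sq_real, norm_smul, inner_smul_right, inner_sub_right,
          real_inner_self_eq_norm_sq, mul_pow, Real.norm_eq_abs, sq_abs, norm_sub_sq_real]
        ring
      have h2 : ‖y‖ ^ 2 < ‖z‖ ^ 2 := by
        have := norm_nonneg y
        nlinarith
      have h3 : 0 < t * (‖z‖ ^ 2 - ‖y‖ ^ 2) := mul_pos ht (by linarith)
      have h4 : 0 ≤ ‖y‖ ^ 2 := by positivity
      rw [hl2, h1]; nlinarith
    have hinv : inversion c l y = z := by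
      rw [inversion_eq_smul, hycn, hyc, hl2, hc, mul_pow]
      match_scalars <;> field_simp <;> ring
    have hk := h c l hl0 hlc y hy (by
      refine le_of_sq_le_sq ?_ (norm_nonneg _)
      rw [hl2, hycn, mul_pow]
      have : t * (t + 1) ≤ (t + 1) ^ 2 := by nlinarith
      gcongr)
    rw [kelvin, hinv] at hk
    convert hk using 2
    have : t / (t + 1) = (l / ‖y - c‖) ^ 2 := by
      rw [div_pow, hl2, hycn]; field_simp
    rw [this, ← Real.rpow_natCast_mul (by positivity)]
    congr 1; push_cast; ring
  have hlim : Tendsto (fun t : ℝ => (t / (t + 1)) ^ (s / 2) * u z) atTop (𝓝 (1 * u z)) := by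
    have h1 : Tendsto (fun t : ℝ => t / (t + 1)) atTop (𝓝 1) := by
      have h2 : Tendsto (fun t : ℝ => 1 - (t + 1)⁻¹) atTop (𝓝 (1 - 0)) :=
        tendsto_const_nhds.sub
          (tendsto_inv_atTop_zero.comp (tendsto_atTop_add_const_right _ _ tendsto_id))
      rw [sub_zero] at h2
      refine h2.congr' ?_
      filter_upwards [eventually_gt_atTop 0] with t ht
      field_simp; ring
    have h3 := h1.rpow_const (p := s / 2) (Or.inl one_ne_zero)
    rw [Real.one_rpow] at h3
    exact h3.mul_const _
  rw [one_mul] at hlim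
  exact le_of_tendsto hlim ((eventually_gt_atTop 0).mono key)

omit [FiniteDimensional ℝ E] in
-- Dilating `z` slightly makes its norm strictly larger, and continuity removes the dilation. The
-- case of equal norms, used in both directions, is radial symmetry.
theorem le_of_norm_le_of_kelvinLE {s : ℝ} {u : E → ℝ} (hu : ∀ y : E, y ≠ 0 → ContinuousAt u y)
    (h : ∀ c : E, ∀ l, 0 < l → l < ‖c‖ → KelvinLE s c u l) {y z : E} (hy : y ≠ 0) (hz : z ≠ 0)
    (hyz : ‖y‖ ≤ ‖z‖) : u z ≤ u y := by
  have hc : ContinuousAt (fun t : ℝ => u (t • z)) 1 :=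
    ContinuousAt.comp' (f := fun t : ℝ => t • z) (by simpa using hu z hz) (by fun_prop)
  have hlim : Tendsto (fun t : ℝ => u (t • z)) (𝓝[>] 1) (𝓝 (u z)) := by
    simpa using hc.tendsto.mono_left nhdsWithin_le_nhds
  refine le_of_tendsto hlim ?_
  filter_upwards [self_mem_nhdsWithin] with t ht
  refine le_of_norm_lt_of_kelvinLE h hy ?_
  have ht' : (1 : ℝ) < t := ht
  rw [norm_smul, Real.norm_of_nonneg (by linarith)]
  have : 0 < ‖z‖ := norm_pos_iff.2 hz
  nlinarith

end MovingSpheres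

/-! ### The fundamental solution as barrier, and the start and step of the induction. -/

section Barrier

open EuclideanGeometry

theorem HasDerivAt.nonneg_of_eventually_nhdsGT {D : ℝ → ℝ} {d l : ℝ} (h : HasDerivAt D d l)
    (h0 : ∀ᶠ t in 𝓝[>] l, D l ≤ D t) : 0 ≤ d := by
  have h1 : Tendsto (slope D l) (𝓝[>] l) (𝓝 d) :=
    (hasDerivAt_iff_tendsto_slope.1 h).mono_left
      (nhdsWithin_mono _ fun t ht => (Set.mem_Ioi.1 ht).ne')
  refine ge_of_tendsto h1 ?_
  filter_upwards [h0, self_mem_nhdsWithin] with t ht htl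
  rw [slope_def_field]
  exact div_nonneg (by linarith) (by have : l < t := htl; linarith)

/-- The drop of `a ↦ a ^ (-q)` over a step of length `κ` decreases in `a`, so it is smallest at `a =
M`. -/
theorem rpow_neg_sub_rpow_neg_ge {q M κ a b : ℝ} (hq : 0 < q) (hκ : 0 < κ) (ha : 0 < a)
    (haM : a ≤ M) (hb : a + κ ≤ b) :
    M ^ (-q) * (1 - (M / (M + κ)) ^ q) ≤ a ^ (-q) - b ^ (-q) := by
  have hM : 0 < M := ha.trans_le haM
  have h1 : b ^ (-q) ≤ (a + κ) ^ (-q) :=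
    Real.rpow_le_rpow_of_nonpos (by positivity) hb (by linarith)
  have h2 : a ^ (-q) - (a + κ) ^ (-q) = a ^ (-q) * (1 - (a / (a + κ)) ^ q) := by
    rw [Real.div_rpow ha.le (by positivity), Real.rpow_neg ha.le, Real.rpow_neg (by positivity)]
    have : a ^ q ≠ 0 := by positivity
    field_simp
  have h3 : M ^ (-q) ≤ a ^ (-q) := Real.rpow_le_rpow_of_nonpos ha haM (by linarith)
  have h4 : (a / (a + κ)) ^ q ≤ (M / (M + κ)) ^ q := by
    refine Real.rpow_le_rpow (by positivity) ?_ hq.le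
    rw [div_le_div_iff₀ (by positivity) (by positivity)]
    nlinarith
  have h5 : (M / (M + κ)) ^ q ≤ 1 :=
    Real.rpow_le_one (by positivity) ((div_le_one (by positivity)).2 (by linarith)) hq.le
  calc M ^ (-q) * (1 - (M / (M + κ)) ^ q) ≤ a ^ (-q) * (1 - (a / (a + κ)) ^ q) := by
        gcongr
    _ ≤ a ^ (-q) - b ^ (-q) := by linarith

theorem one_sub_div_rpow_pos {q M κ : ℝ} (hq : 0 < q) (hκ : 0 < κ) (hM : 0 < M) :
    0 < M ^ (-q) * (1 - (M / (M + κ)) ^ q) := by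
  have : (M / (M + κ)) ^ q < 1 :=
    Real.rpow_lt_one (by positivity) ((div_lt_one (by positivity)).2 (by linarith)) hq
  exact mul_pos (by positivity) (by linarith)

theorem exists_div_rpow_le {s : ℝ} (hs : 0 < s) (δ : ℝ) {a : ℝ} (ha : 0 < a) :
    ∃ R, ∀ t, R ≤ t → (δ / t) ^ s ≤ a := by
  have h1 : Tendsto (fun t : ℝ => (δ / t) ^ s) atTop (𝓝 (0 ^ s)) :=
    (tendsto_const_nhds.div_atTop tendsto_id).rpow_const (Or.inr hs.le)
  rw [Real.zero_rpow hs.ne'] at h1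
  obtain ⟨R, hR⟩ := eventually_atTop.1 (h1.eventually_le_const ha)
  exact ⟨R, hR⟩

variable {E : Type*} [NormedAddCommGroup E] [InnerProductSpace ℝ E]

theorem inversion_ne_zero {c y : E} {l : ℝ} (hl : 0 < l) (hlc : l < ‖c‖) (hy : l ≤ ‖y - c‖) :
    inversion c l y ≠ 0 := by
  intro h0
  have h1 := norm_inversion_sub_center c l y
  rw [h0, zero_sub, norm_neg] at h1
  have : l ^ 2 / ‖y - c‖ ≤ l := by rw [div_le_iff₀ (hl.trans_le hy)]; nlinarith
  linarith

/-- The expression equals `s / 2` times the fundamental solution times `(‖c‖ ^ 2 - l ^ 2) / ‖c + l •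
θ‖ ^ 2`, positive because the pole lies outside the sphere. It replaces Hopf's lemma. -/
theorem half_mul_add_fderiv_kelvin_one_pos {s δ : ℝ} (hs : 0 < s) (hδ : 0 < δ) {c θ : E} {l : ℝ}
    (hl : 0 < l) (hlc : l < ‖c‖) (hθ : ‖θ‖ = 1) :
    0 < s / 2 * kelvin s 0 δ (fun _ => 1) (c + l • θ)
      + l * fderiv ℝ (kelvin s 0 δ (fun _ => 1)) (c + l • θ) θ := by
  have hne : c + l • θ ≠ 0 :=
    add_smul_ne_zero (by rwa [norm_smul, hθ, mul_one, Real.norm_of_nonneg hl.le])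
  have hN : ∀ t : ℝ, ‖c + t • θ‖ ^ 2 = ‖c‖ ^ 2 + 2 * inner ℝ c θ * t + t ^ 2 := by
    intro t
    rw [norm_add_sq_real, norm_smul, hθ, inner_smul_right]
    simp [sq_abs]; ring
  have hΓ : ∀ z : E, kelvin s 0 δ (fun _ => 1) z = δ ^ s * (‖z‖ ^ 2) ^ (-s / 2) := by
    intro z
    rw [kelvin_eq_norm_sq s 0 hδ]
    simp
  have hpos : 0 < ‖c + l • θ‖ ^ 2 := by have := norm_pos_iff.2 hne; positivity
  have hd : HasDerivAt (fun t : ℝ => kelvin s 0 δ (fun _ => 1) (c + t • θ))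
      (δ ^ s * ((2 * inner ℝ c θ + 2 * l) * (-s / 2) * (‖c + l • θ‖ ^ 2) ^ (-s / 2 - 1))) l := by
    simp only [hΓ, hN]
    rw [hN] at hpos
    exact ((hasDerivAt_quadratic _ _ l).rpow_const (Or.inl hpos.ne')).const_mul _
  have hd' : HasDerivAt (fun t : ℝ => kelvin s 0 δ (fun _ => 1) (c + t • θ))
      (fderiv ℝ (kelvin s 0 δ (fun _ => 1)) (c + l • θ) θ) l := by
    have hl : HasDerivAt (fun t : ℝ => c + t • θ) θ l := by
      simpa using ((hasDerivAt_id l).smul_const θ).const_add c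
    exact ((kelvin_contDiffAt hδ hne contDiffAt_const).differentiableAt
      (by simp)).hasFDerivAt.comp_hasDerivAt l hl
  rw [hd'.unique hd, hΓ, Real.rpow_sub_one hpos.ne']
  have h1 : s / 2 * (δ ^ s * (‖c + l • θ‖ ^ 2) ^ (-s / 2)) + l * (δ ^ s * ((2 * inner ℝ c θ + 2 * l)
      * (-s / 2) * ((‖c + l • θ‖ ^ 2) ^ (-s / 2) / ‖c + l • θ‖ ^ 2))) =
      s / 2 * (δ ^ s * (‖c + l • θ‖ ^ 2) ^ (-s / 2)) / ‖c + l • θ‖ ^ 2 *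
        (‖c + l • θ‖ ^ 2 - l * (2 * inner ℝ c θ + 2 * l)) := by
    field_simp
    ring
  rw [h1]
  have h2 : ‖c + l • θ‖ ^ 2 - l * (2 * inner ℝ c θ + 2 * l) = ‖c‖ ^ 2 - l ^ 2 := by
    rw [hN]; ring
  rw [h2]
  have h3 : 0 < ‖c‖ ^ 2 - l ^ 2 := by nlinarith
  positivity

/-- The Green-type difference of the fundamental solution and its Kelvin transform, away from the
sphere. -/
theorem exists_le_kelvin_one_sub_kelvin {s δ : ℝ} (hs : 0 < s) (hδ : 0 < δ) {c : E} {l η : ℝ}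
    (hl : 0 < l) (hlc : l < ‖c‖) (hη : 0 < η) :
    ∃ m > 0, ∀ y : E, y ≠ 0 → l + η ≤ ‖y - c‖ →
      m ≤ ‖y - c‖ ^ s * (kelvin s 0 δ (fun _ => 1) y
        - kelvin s c l (kelvin s 0 δ (fun _ => 1)) y) := by
  -- After weighting, the difference compares negative powers of `(‖y‖ / ‖y - c‖) ^ 2` and
  -- `(‖inversion c l y‖ / l) ^ 2`. By `norm_inversion_sub_sq` at `0` these differ by at least `κ`,
  -- and the first is at most `M`.
  set κ : ℝ := (1 - (l / (l + η)) ^ 2) * ((‖c‖ ^ 2 - l ^ 2) / l ^ 2) with hκ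
  set M : ℝ := (1 + ‖c‖ / (l + η)) ^ 2 with hM
  have hM0 : 0 < M := by positivity
  have hκ0 : 0 < κ := by
    have h1 : l / (l + η) < 1 := (div_lt_one (by positivity)).2 (by linarith)
    have h2 : 0 < l / (l + η) := by positivity
    have h3 : 0 < 1 - (l / (l + η)) ^ 2 := by nlinarith
    have h4 : 0 < ‖c‖ ^ 2 - l ^ 2 := by nlinarith
    positivity
  refine ⟨δ ^ s * (M ^ (-(s / 2)) * (1 - (M / (M + κ)) ^ (s / 2))),
    mul_pos (by positivity) (one_sub_div_rpow_pos (by positivity) hκ0 hM0), fun y hy hly => ?_⟩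
  have hρ : 0 < ‖y - c‖ := (by positivity : 0 < l + η).trans_le hly
  have hyc : y ≠ c := sub_ne_zero.1 (norm_pos_iff.1 hρ)
  have hT := inversion_ne_zero hl hlc (y := y) (by linarith)
  have hy0 : 0 < ‖y‖ := norm_pos_iff.2 hy
  have hT0 : 0 < ‖inversion c l y‖ := norm_pos_iff.2 hT
  have hpow : ∀ x : ℝ, 0 < x → (x ^ 2) ^ (-(s / 2)) = x ^ (-s) := by
    intro x hx
    rw [← Real.rpow_natCast_mul hx.le]; congr 1; push_cast; ring
  have h1 : ‖y - c‖ ^ s * (kelvin s 0 δ (fun _ => 1) y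
        - kelvin s c l (kelvin s 0 δ (fun _ => 1)) y) =
      δ ^ s * (((‖y‖ / ‖y - c‖) ^ 2) ^ (-(s / 2))
        - ((‖inversion c l y‖ / l) ^ 2) ^ (-(s / 2))) := by
    rw [hpow _ (by positivity), hpow _ (by positivity), kelvin_one_apply, kelvin, kelvin_one_apply,
      Real.div_rpow hδ.le hy0.le, Real.div_rpow hl.le hρ.le, Real.div_rpow hδ.le hT0.le,
      Real.div_rpow hy0.le hρ.le, Real.div_rpow hT0.le hl.le, Real.rpow_neg hy0.le,
      Real.rpow_neg hρ.le, Real.rpow_neg hl.le, Real.rpow_neg hT0.le]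
    have : ‖y‖ ^ s ≠ 0 := by positivity
    have : ‖y - c‖ ^ s ≠ 0 := by positivity
    have : ‖inversion c l y‖ ^ s ≠ 0 := by positivity
    have : l ^ s ≠ 0 := by positivity
    field_simp
  rw [h1]
  refine mul_le_mul_of_nonneg_left (rpow_neg_sub_rpow_neg_ge (by positivity) hκ0 (by positivity)
    ?_ ?_) (by positivity)
  · rw [hM]
    refine pow_le_pow_left₀ (by positivity) ?_ 2
    have h2 : ‖y‖ ≤ ‖y - c‖ + ‖c‖ := by simpa using norm_add_le (y - c) c
    calc ‖y‖ / ‖y - c‖ ≤ (‖y - c‖ + ‖c‖) / ‖y - c‖ := by gcongr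
      _ = 1 + ‖c‖ / ‖y - c‖ := by field_simp
      _ ≤ 1 + ‖c‖ / (l + η) := by gcongr
  · have h3 := norm_inversion_sub_sq (r := l) hyc 0
    simp only [sub_zero, zero_sub, norm_neg] at h3
    have h4 : (‖inversion c l y‖ / l) ^ 2 = (‖y‖ / ‖y - c‖) ^ 2
        + (1 - (l / ‖y - c‖) ^ 2) * ((‖c‖ ^ 2 - l ^ 2) / l ^ 2) := by
      field_simp
      linarith
    rw [h4, hκ]
    have h5 : 0 < ‖c‖ ^ 2 - l ^ 2 := by nlinarith
    gcongr

variable [FiniteDimensional ℝ E] [Nontrivial E]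

/-- A positive superharmonic function that blows up at the origin dominates a multiple of the
fundamental solution. -/
theorem exists_kelvin_one_le {s : ℝ} (hs : 0 < s) (hsd : s = Module.finrank ℝ E - 2) {u : E → ℝ}
    (hu : ∀ y : E, y ≠ 0 → ContDiffAt ℝ 2 u y) (hpos : ∀ y : E, y ≠ 0 → 0 < u y)
    (hΔ : ∀ y : E, y ≠ 0 → (Δ u) y ≤ 0) (hsing : ∀ M : ℝ, ∀ᶠ y in 𝓝[≠] (0 : E), M < u y) :
    ∃ δ > 0, (∀ y : E, y ≠ 0 → ‖y‖ ≤ δ → 1 ≤ u y) ∧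
      ∀ y : E, δ ≤ ‖y‖ → kelvin s 0 δ (fun _ => 1) y ≤ u y := by
  obtain ⟨δ', hδ', hδ1⟩ := Metric.eventually_nhds_iff.1
    (eventually_nhdsWithin_iff.1 (hsing 1))
  set δ := δ' / 2 with hδd
  have hδ : 0 < δ := by positivity
  have hnear : ∀ y : E, y ≠ 0 → ‖y‖ ≤ δ → 1 ≤ u y := fun y hy hyδ =>
    (hδ1 (by rw [dist_zero_right]; linarith) hy).le
  have hne : ∀ y : E, δ ≤ ‖y‖ → y ≠ 0 := fun y hy => norm_pos_iff.1 (hδ.trans_le hy)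
  have hΓ : ∀ y : E, y ≠ 0 → ContDiffAt ℝ 2 (kelvin s (0 : E) δ (fun _ => 1)) y :=
    fun y hy => kelvin_contDiffAt hδ hy contDiffAt_const
  refine ⟨δ, hδ, hnear, fun y hy => ?_⟩
  -- On `‖y‖ = δ` the fundamental solution is `1 ≤ u`, and at infinity it vanishes while `u` is
  -- positive.
  have key := IsClosed.superharmonic_nonneg (S := {y : E | δ ≤ ‖y‖}) (U := {y : E | δ < ‖y‖})
    (f := u - kelvin s 0 δ (fun _ => 1))
    (isClosed_le continuous_const continuous_norm) (isOpen_lt continuous_const continuous_norm)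
    (fun y (hy : δ < ‖y‖) => hy.le)
    (fun y hy => ((hu y (hne y hy)).sub (hΓ y (hne y hy))).continuousAt.continuousWithinAt)
    (fun y (hy : δ < ‖y‖) => (hu y (hne y hy.le)).sub (hΓ y (hne y hy.le))) ?_ ?_ ?_ y hy
  · simpa using key
  · intro y (hy : δ < ‖y‖)
    rw [(hu y (hne y hy.le)).laplacian_sub (hΓ y (hne y hy.le)),
      laplacian_kelvin_one hsd hδ (hne y hy.le), sub_zero]
    exact hΔ y (hne y hy.le)
  · rintro y ⟨hy1 : δ ≤ ‖y‖, hy2 : ¬ (δ < ‖y‖)⟩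
    have h1 : ‖y‖ = δ := le_antisymm (not_lt.1 hy2) hy1
    have h2 := hnear y (hne y hy1) h1.le
    simp only [Pi.sub_apply, kelvin_one_apply, h1, div_self hδ.ne', Real.one_rpow]
    linarith
  · intro a ha
    obtain ⟨R, hR⟩ := exists_div_rpow_le hs δ ha
    refine ⟨R, fun y hy hRy => ?_⟩
    have h1 := hR _ hRy
    have h2 := hpos y (hne y hy)
    simp only [Pi.sub_apply, kelvin_one_apply]
    linarith

/-- At radius `0` the transform is identically zero, since `s > 0`, so the continuation step with `l
= 0` applies once `‖y - c‖ ^ s * u y` is bounded below away from `c`. That bound is the domination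
of the fundamental solution. -/
theorem exists_kelvinLE_near_zero {s : ℝ} (hs : 0 < s) (hsd : s = Module.finrank ℝ E - 2)
    {u : E → ℝ} (hu : ∀ y : E, y ≠ 0 → ContDiffAt ℝ 2 u y) (hpos : ∀ y : E, y ≠ 0 → 0 < u y)
    (hΔ : ∀ y : E, y ≠ 0 → (Δ u) y ≤ 0) (hsing : ∀ M : ℝ, ∀ᶠ y in 𝓝[≠] (0 : E), M < u y)
    {c : E} (hc : c ≠ 0) : ∃ ε > 0, ∀ r, 0 < r → r < ε → KelvinLE s c u r := by
  have hcn : 0 < ‖c‖ := norm_pos_iff.2 hc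
  obtain ⟨δ, hδ, hδ1, hδ2⟩ := exists_kelvin_one_le hs hsd hu hpos hΔ hsing
  have key := exists_kelvinLE_of_gt hs hu (c := c) (l := 0) le_rfl hcn ?_ ?_
  · simpa using key
  · intro η hη
    refine ⟨min (η ^ s) ((δ / (1 + ‖c‖ / η)) ^ s), lt_min (by positivity) (by positivity),
      fun y hy hly => ?_⟩
    rw [zero_add] at hly
    have hρ : 0 < ‖y - c‖ := hη.trans_le hly
    have h0 : kelvin s c 0 u y = 0 := by simp [kelvin, Real.zero_rpow hs.ne']
    rw [h0, sub_zero]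
    rcases le_total ‖y‖ δ with h | h
    · refine (min_le_left _ _).trans ?_
      have h1 := hδ1 y hy h
      have h2 : η ^ s ≤ ‖y - c‖ ^ s := Real.rpow_le_rpow hη.le hly hs.le
      nlinarith [Real.rpow_pos_of_pos hη s]
    · refine (min_le_right _ _).trans ?_
      have h1 := hδ2 y h
      have hy0 : 0 < ‖y‖ := norm_pos_iff.2 hy
      rw [kelvin_one_apply] at h1
      refine le_trans ?_ (mul_le_mul_of_nonneg_left h1 (by positivity))
      rw [← Real.mul_rpow (by positivity) (by positivity)]
      refine Real.rpow_le_rpow (by positivity) ?_ hs.le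
      have h2 : ‖y‖ ≤ ‖y - c‖ + ‖c‖ := by simpa using norm_add_le (y - c) c
      rw [mul_div_assoc', div_le_div_iff₀ (by positivity) hy0]
      have h3 : ‖y‖ ≤ ‖y - c‖ * (1 + ‖c‖ / η) := by
        have : ‖c‖ ≤ ‖y - c‖ * (‖c‖ / η) := by
          rw [mul_div_assoc', le_div_iff₀ hη]; nlinarith
        linarith
      nlinarith
  · intro θ _
    simpa using mul_pos (half_pos hs) (hpos c hc)

/-- Comparison of `u` with its Kelvin transform by means of the fundamental solution. -/
theorem exists_kelvin_sub_le {s : ℝ} (hs : 0 < s) (hsd : s = Module.finrank ℝ E - 2)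
    {u : E → ℝ} (hu : ∀ y : E, y ≠ 0 → ContDiffAt ℝ 2 u y)
    (hsing : ∀ M : ℝ, ∀ᶠ y in 𝓝[≠] (0 : E), M < u y)
    {c : E} {l : ℝ} (hl : 0 < l) (hlc : l < ‖c‖) (hle : KelvinLE s c u l)
    (hΔ : ∀ y : E, y ≠ 0 → l < ‖y - c‖ → (Δ u) y ≤ (Δ (kelvin s c l u)) y) :
    ∃ δ > 0, δ < ‖c‖ - l ∧ (∀ y : E, y ≠ 0 → ‖y‖ ≤ δ → kelvin s c l u y + 1 ≤ u y) ∧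
      ∀ y : E, δ ≤ ‖y‖ → l ≤ ‖y - c‖ → kelvin s c l (u - kelvin s (0 : E) δ (fun _ => 1)) y ≤
        (u - kelvin s (0 : E) δ (fun _ => 1)) y := by
  have hyc : ∀ y : E, l ≤ ‖y - c‖ → y ≠ c := fun y hy =>
    sub_ne_zero.1 (norm_pos_iff.1 (hl.trans_le hy))
  have hkc : ContinuousAt (kelvin s c l u) 0 :=
    (kelvin_contDiffAt hl (hyc 0 (by simpa using hlc.le))
      (hu _ (inversion_ne_zero hl hlc (by simpa using hlc.le)))).continuousAt
  -- Here the singularity enters: the inverse point of `0` is not `0`, so the transform is bounded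
  -- near `0` while `u` is not. The gap `1` is the value of the barrier on `‖y‖ = δ`.
  have hev : ∀ᶠ y in 𝓝[≠] (0 : E), kelvin s c l u y + 1 ≤ u y := by
    have h1 : ∀ᶠ y in 𝓝[≠] (0 : E), kelvin s c l u y < kelvin s c l u 0 + 1 :=
      (hkc.eventually_lt_const (by linarith)).filter_mono nhdsWithin_le_nhds
    filter_upwards [h1, hsing (kelvin s c l u 0 + 2)] with y h h'
    linarith
  obtain ⟨δ', hδ', hδ1⟩ := Metric.eventually_nhds_iff.1 (eventually_nhdsWithin_iff.1 hev)
  set δ := min (δ' / 2) ((‖c‖ - l) / 2) with hδd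
  have hδ : 0 < δ := lt_min (by positivity) (by linarith)
  have hδl : δ < ‖c‖ - l := (min_le_right _ _).trans_lt (by linarith)
  have hnear : ∀ y : E, y ≠ 0 → ‖y‖ ≤ δ → kelvin s c l u y + 1 ≤ u y := fun y hy hyδ =>
    hδ1 (by rw [dist_zero_right]; have := min_le_left (δ' / 2) ((‖c‖ - l) / 2); linarith) hy
  refine ⟨δ, hδ, hδl, hnear, fun y hy1 hy2 => ?_⟩
  set Γ : E → ℝ := kelvin s 0 δ (fun _ => 1) with hΓd
  have hne : ∀ y : E, δ ≤ ‖y‖ → y ≠ 0 := fun y hy => norm_pos_iff.1 (hδ.trans_le hy)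
  have hΓ : ∀ y : E, y ≠ 0 → ContDiffAt ℝ 2 Γ y :=
    fun y hy => kelvin_contDiffAt hδ hy contDiffAt_const
  have hT : ∀ y : E, l ≤ ‖y - c‖ → inversion c l y ≠ 0 := fun y => inversion_ne_zero hl hlc
  have hku : ∀ y : E, l ≤ ‖y - c‖ → ContDiffAt ℝ 2 (kelvin s c l u) y := fun y hy =>
    kelvin_contDiffAt hl (hyc y hy) (hu _ (hT y hy))
  have hkΓ : ∀ y : E, l ≤ ‖y - c‖ → ContDiffAt ℝ 2 (kelvin s c l Γ) y := fun y hy =>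
    kelvin_contDiffAt hl (hyc y hy) (hΓ _ (hT y hy))
  have hΓ0 : ∀ y, 0 ≤ Γ y := fun y => by rw [hΓd, kelvin_one_apply]; positivity
  have hkΓ0 : ∀ y, 0 ≤ kelvin s c l Γ y := fun y => mul_nonneg (by positivity) (hΓ0 _)
  have hf : ∀ y : E, δ ≤ ‖y‖ → l ≤ ‖y - c‖ →
      ContDiffAt ℝ 2 ((u - Γ) - (kelvin s c l u - kelvin s c l Γ)) y := fun y h1 h2 =>
    ((hu y (hne y h1)).sub (hΓ y (hne y h1))).sub ((hku y h2).sub (hkΓ y h2))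
  have hcont : Continuous fun y : E => ‖y - c‖ := by fun_prop
  -- In this region both barriers are harmonic. The difference vanishes on the sphere about `c`, is
  -- nonnegative on `‖y‖ = δ` by the gap, and at infinity `hle` applies with a vanishing error.
  have key := IsClosed.superharmonic_nonneg (S := {y : E | δ ≤ ‖y‖} ∩ {y : E | l ≤ ‖y - c‖})
    (U := {y : E | δ < ‖y‖} ∩ {y : E | l < ‖y - c‖})
    (f := (u - Γ) - (kelvin s c l u - kelvin s c l Γ))
    ((isClosed_le continuous_const continuous_norm).inter (isClosed_le continuous_const hcont))
    ((isOpen_lt continuous_const continuous_norm).inter (isOpen_lt continuous_const hcont))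
    (fun y hy => ⟨(show δ < ‖y‖ from hy.1).le, (show l < ‖y - c‖ from hy.2).le⟩)
    (fun y hy => (hf y hy.1 hy.2).continuousAt.continuousWithinAt)
    (fun y hy => hf y (show δ < ‖y‖ from hy.1).le (show l < ‖y - c‖ from hy.2).le)
    ?_ ?_ ?_ y ⟨hy1, hy2⟩
  · rw [← kelvin_sub] at key
    exact sub_nonneg.1 key
  · rintro y ⟨h1 : δ < ‖y‖, h2 : l < ‖y - c‖⟩
    have hy0 := hne y h1.le
    have hs1 : ContDiffAt ℝ 2 (u - Γ) y := (hu y hy0).sub (hΓ y hy0)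
    have hs2 : ContDiffAt ℝ 2 (kelvin s c l u - kelvin s c l Γ) y := (hku y h2.le).sub (hkΓ y h2.le)
    rw [hs1.laplacian_sub hs2,
      (hu y hy0).laplacian_sub (hΓ y hy0), (hku y h2.le).laplacian_sub (hkΓ y h2.le),
      laplacian_kelvin hsd hl (hyc y h2.le) (hΓ _ (hT y h2.le)), hΓd,
      laplacian_kelvin_one hsd hδ hy0, laplacian_kelvin_one hsd hδ (hT y h2.le)]
    have := hΔ y hy0 h2
    linarith
  · rintro y ⟨⟨h1 : δ ≤ ‖y‖, h2 : l ≤ ‖y - c‖⟩, hyU⟩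
    rcases h2.eq_or_lt with h3 | h3
    · have h4 : inversion c l y = y := inversion_of_mem_sphere (by simpa using h3.symm)
      simp [kelvin, h4, ← h3, div_self hl.ne']
    · have h4 : ‖y‖ = δ := le_antisymm (not_lt.1 fun h => hyU ⟨h, h3⟩) h1
      have h5 := hnear y (hne y h1) h4.le
      have h6 : Γ y = 1 := by rw [hΓd, kelvin_one_apply, h4, div_self hδ.ne', Real.one_rpow]
      have h7 := hkΓ0 y
      simp only [Pi.sub_apply, h6]
      linarith
  · intro a ha
    obtain ⟨R, hR⟩ := exists_div_rpow_le hs δ ha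
    refine ⟨R, fun y hy hRy => ?_⟩
    have h1 : Γ y ≤ a := by rw [hΓd, kelvin_one_apply]; exact hR _ hRy
    have h2 := hle y (hne y hy.1) hy.2
    have h3 := hkΓ0 y
    simp only [Pi.sub_apply]
    linarith

theorem exists_kelvinLE_gt_of_laplacian_le {s : ℝ} (hs : 0 < s)
    (hsd : s = Module.finrank ℝ E - 2)
    {u : E → ℝ} (hu : ∀ y : E, y ≠ 0 → ContDiffAt ℝ 2 u y)
    (hsing : ∀ M : ℝ, ∀ᶠ y in 𝓝[≠] (0 : E), M < u y)
    {c : E} {l : ℝ} (hl : 0 < l) (hlc : l < ‖c‖) (hle : KelvinLE s c u l)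
    (hΔ : ∀ y : E, y ≠ 0 → l < ‖y - c‖ → (Δ u) y ≤ (Δ (kelvin s c l u)) y) :
    ∃ ε > 0, ∀ r, l < r → r < l + ε → KelvinLE s c u r := by
  obtain ⟨δ, hδ, hδl, hδ1, hδ2⟩ := exists_kelvin_sub_le hs hsd hu hsing hl hlc hle hΔ
  refine exists_kelvinLE_of_gt hs hu hl.le hlc ?_ ?_
  · intro η hη
    obtain ⟨m, hm, hmf⟩ := exists_le_kelvin_one_sub_kelvin hs hδ hl hlc hη
    refine ⟨min (l ^ s) m, lt_min (by positivity) hm, fun y hy hly => ?_⟩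
    have hρ : 0 < ‖y - c‖ := (by positivity : 0 < l + η).trans_le hly
    rcases le_total ‖y‖ δ with h | h
    · refine (min_le_left _ _).trans ?_
      have h1 := hδ1 y hy h
      have h2 : l ^ s ≤ ‖y - c‖ ^ s := Real.rpow_le_rpow hl.le (by linarith) hs.le
      nlinarith [Real.rpow_pos_of_pos hl s]
    · refine (min_le_right _ _).trans ((hmf y hy hly).trans ?_)
      have h1 := hδ2 y h (by linarith)
      rw [kelvin_sub] at h1
      simp only [Pi.sub_apply] at h1
      gcongr ?_ * ?_
      linarith
  · intro θ hθ
    set Γ : E → ℝ := kelvin s 0 δ (fun _ => 1) with hΓd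
    have hne : c + l • θ ≠ 0 :=
      add_smul_ne_zero (by rwa [norm_smul, hθ, mul_one, Real.norm_of_nonneg hl.le])
    have hgd : DifferentiableAt ℝ (u - Γ) (c + l • θ) :=
      ((hu _ hne).sub (kelvin_contDiffAt hδ hne contDiffAt_const)).differentiableAt (by simp)
    have hud : DifferentiableAt ℝ u (c + l • θ) := (hu _ hne).differentiableAt (by simp)
    have hΓdiff : DifferentiableAt ℝ Γ (c + l • θ) :=
      (kelvin_contDiffAt hδ hne contDiffAt_const).differentiableAt (by simp)
    set Φ : ℝ → ℝ := fun t => t ^ (s / 2) * (u - Γ) (c + t • θ) with hΦ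
    set p : ℝ := l ^ (s / 2 - 1) *
      (s / 2 * (u - Γ) (c + l • θ) + l * fderiv ℝ (u - Γ) (c + l • θ) θ) with hp
    have hΦd : HasDerivAt Φ p l := hasDerivAt_rpow_mul_ray hl hgd
    have hinv : HasDerivAt (fun t : ℝ => l ^ 2 / t) (-1) l := by
      refine ((hasDerivAt_const l (l ^ 2)).fun_div (hasDerivAt_id l) hl.ne').congr_deriv ?_
      simp only [id]; field_simp; ring
    have hll : l ^ 2 / l = l := by field_simp
    have hΦd' : HasDerivAt (fun t : ℝ => Φ (l ^ 2 / t)) (p * -1) l :=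
      HasDerivAt.comp l (h₂ := Φ) (h := fun t : ℝ => l ^ 2 / t) (h₂' := p)
        (by rw [hll]; exact hΦd) hinv
    -- For `u - Γ` the comparison says `Φ (l ^ 2 / t) ≤ Φ t` for `t > l` near `l`, with equality at
    -- `t = l`. Hence `2 * p ≥ 0`, and adding back `Γ` makes the radial quantity of `u` strictly
    -- positive.
    have hD := (hΦd.fun_sub hΦd').nonneg_of_eventually_nhdsGT (l := l) ?_
    · have hp0 : 0 ≤ p := by linarith
      have h1 : 0 ≤ s / 2 * (u - Γ) (c + l • θ) + l * fderiv ℝ (u - Γ) (c + l • θ) θ :=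
        nonneg_of_mul_nonneg_right hp0 (by positivity)
      rw [fderiv_sub hud hΓdiff] at h1
      have h2 := half_mul_add_fderiv_kelvin_one_pos hs hδ hl hlc hθ
      simp only [Pi.sub_apply, sub_apply] at h1
      simp only [← hΓd] at h2
      linarith
    · have hlow : ∀ᶠ t in 𝓝[>] l, δ < ‖c + t • θ‖ := by
        have hc : ContinuousAt (fun t : ℝ => ‖c + t • θ‖) l := by fun_prop
        refine (hc.eventually_const_lt ?_).filter_mono nhdsWithin_le_nhds
        have h1 : ‖c‖ ≤ ‖c + l • θ‖ + ‖l • θ‖ := by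
          simpa using norm_sub_le (c + l • θ) (l • θ)
        rw [norm_smul, hθ, mul_one, Real.norm_of_nonneg hl.le] at h1
        linarith
      filter_upwards [hlow, self_mem_nhdsWithin] with t ht (htl : l < t)
      have ht0 : 0 < t := hl.trans htl
      have hyn : ‖c + t • θ - c‖ = t := by
        rw [add_sub_cancel_left, norm_smul, hθ, mul_one, Real.norm_of_nonneg ht0.le]
      have h1 := hδ2 (c + t • θ) ht.le (by rw [hyn]; exact htl.le)
      rw [kelvin_le_iff_ray hl (sub_ne_zero.1 (norm_pos_iff.1 (by rw [hyn]; exact ht0))), hyn,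
        add_sub_cancel_left, smul_smul t⁻¹, inv_mul_cancel₀ ht0.ne', one_smul] at h1
      rw [hll, sub_self]
      exact sub_nonneg.2 h1

end Barrier

/-! ### The Hartree nonlinearity: transfer of the comparison to the Laplacians. -/

section Hartree

open EuclideanGeometry
open scoped ENNReal

theorem critExp_pos {n : ℕ} (hn : 3 ≤ n) {α : ℝ} (hα0 : 0 < α) : 0 < critExp n α := by
  have hn' : (3 : ℝ) ≤ n := by exact_mod_cast hn
  exact div_pos (by linarith) (by linarith)

theorem sub_two_mul_critExp {n : ℕ} (hn : 3 ≤ n) (α : ℝ) :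
    ((n : ℝ) - 2) * critExp n α = n + α := by
  have hn' : (3 : ℝ) ≤ n := by exact_mod_cast hn
  rw [critExp, mul_div_cancel₀]
  linarith

theorem one_lt_critExp {n : ℕ} (hn : 3 ≤ n) {α : ℝ} (hα0 : 0 < α) : 1 < critExp n α := by
  have hn' : (3 : ℝ) ≤ n := by exact_mod_cast hn
  rw [critExp, one_lt_div (by linarith)]
  linarith

theorem hartreef_of_pos {n : ℕ} {α ξ : ℝ} (hξ : 0 < ξ) :
    hartreef n α ξ = ξ ^ (critExp n α - 1) := by
  rw [hartreef, abs_of_pos hξ, ← Real.rpow_add_one hξ.ne']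
  congr 1; ring

theorem hartreeF_nonneg {n : ℕ} (hn : 3 ≤ n) {α : ℝ} (hα0 : 0 < α) (ξ : ℝ) :
    0 ≤ hartreeF n α ξ :=
  mul_nonneg (critExp_pos hn hα0).le (by positivity)

theorem IsSingularAtZero.eventually_gt {n : ℕ} {u : EuclideanSpace ℝ (Fin n) → ℝ}
    (h : IsSingularAtZero u) (M : ℝ) :
    ∀ᶠ y in 𝓝[≠] (0 : EuclideanSpace ℝ (Fin n)), M < u y := by
  have h1 : (M : EReal) < liminf (fun x => (u x : EReal)) (𝓝[≠] 0) := by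
    rw [h]; exact EReal.coe_lt_top M
  filter_upwards [eventually_lt_of_lt_liminf h1] with y hy
  exact_mod_cast hy

namespace IsHartreeSolution

variable {n : ℕ} {α : ℝ} {u : EuclideanSpace ℝ (Fin n) → ℝ}

theorem contDiffAt (h : IsHartreeSolution n α u) {y : EuclideanSpace ℝ (Fin n)} (hy : y ≠ 0) :
    ContDiffAt ℝ 2 u y :=
  h.contDiffOn.contDiffAt (isOpen_compl_singleton.mem_nhds hy)

theorem aemeasurable_hartreeF [Nontrivial (EuclideanSpace ℝ (Fin n))]
    (h : IsHartreeSolution n α u) : AEMeasurable (fun y => hartreeF n α (u y)) volume := by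
  have h1 : AEMeasurable u (volume.restrict {0}ᶜ) :=
    h.contDiffOn.continuousOn.aemeasurable (measurableSet_singleton _).compl
  rw [Measure.restrict_eq_self_of_ae_mem (by simp [ae_iff])] at h1
  unfold hartreeF
  fun_prop

/-- Passing to `ℝ≥0∞` lets the integral be split and inverted without integrability checks on the
pieces. -/
theorem ofReal_convolution (hn : 3 ≤ n) (hα0 : 0 < α) (h : IsHartreeSolution n α u)
    {x : EuclideanSpace ℝ (Fin n)} (hx : x ≠ 0) :
    ENNReal.ofReal ((rieszKernel n α ⋆ (fun y => hartreeF n α (u y))) x) =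
      ∫⁻ z, ENNReal.ofReal (‖x - z‖ ^ (-((n : ℝ) - α))) * ENNReal.ofReal (hartreeF n α (u z)) := by
  have hk : ∀ t, 0 ≤ rieszKernel n α t := fun t => by unfold rieszKernel; positivity
  have hint := (h.convolutionExists x hx).integrable_swap
  simp only [ContinuousLinearMap.lsmul_apply, smul_eq_mul] at hint
  rw [convolution_lsmul_swap]
  simp only [smul_eq_mul]
  rw [ofReal_integral_eq_lintegral_ofReal hint
    (.of_forall fun z => mul_nonneg (hk _) (hartreeF_nonneg hn hα0 _))]
  congr 1; ext z
  rw [ENNReal.ofReal_mul (hk _), rieszKernel, neg_sub]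

theorem convolution_pos [Nontrivial (EuclideanSpace ℝ (Fin n))] (hn : 3 ≤ n) (hα0 : 0 < α)
    (h : IsHartreeSolution n α u) (hpos : ∀ x : EuclideanSpace ℝ (Fin n), x ≠ 0 → 0 < u x)
    {x : EuclideanSpace ℝ (Fin n)} (hx : x ≠ 0) :
    0 < (rieszKernel n α ⋆ (fun y => hartreeF n α (u y))) x := by
  rw [← ENNReal.ofReal_pos, h.ofReal_convolution hn hα0 hx, pos_iff_ne_zero, Ne,
    lintegral_eq_zero_iff' (by have := h.aemeasurable_hartreeF; fun_prop)]
  intro h0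
  have h1 : ∀ᵐ z : EuclideanSpace ℝ (Fin n), z ≠ 0 ∧ z ≠ x :=
    Filter.Eventually.and (by simp [ae_iff]) (by simp [ae_iff])
  obtain ⟨z, hz0, hz1, hz2⟩ := (h0.and h1).exists
  have h2 : 0 < ‖x - z‖ := norm_pos_iff.2 (sub_ne_zero.2 hz2.symm)
  have h3 : 0 < hartreeF n α (u z) :=
    mul_pos (critExp_pos hn hα0) (Real.rpow_pos_of_pos (abs_pos.2 (hpos z hz1).ne') _)
  have h4 := ENNReal.mul_pos (ENNReal.ofReal_pos.2 (Real.rpow_pos_of_pos h2 (-((n : ℝ) - α)))).ne'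
    (ENNReal.ofReal_pos.2 h3).ne'
  exact h4.ne' hz0

theorem laplacian_eq (h : IsHartreeSolution n α u)
    (hpos : ∀ x : EuclideanSpace ℝ (Fin n), x ≠ 0 → 0 < u x)
    {x : EuclideanSpace ℝ (Fin n)} (hx : x ≠ 0) :
    (Δ u) x = -((rieszKernel n α ⋆ (fun y => hartreeF n α (u y))) x *
      u x ^ (critExp n α - 1)) := by
  rw [← hartreef_of_pos (hpos x hx), ← h.equation x hx, neg_neg]

theorem laplacian_neg [Nontrivial (EuclideanSpace ℝ (Fin n))] (hn : 3 ≤ n) (hα0 : 0 < α)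
    (h : IsHartreeSolution n α u) (hpos : ∀ x : EuclideanSpace ℝ (Fin n), x ≠ 0 → 0 < u x)
    {x : EuclideanSpace ℝ (Fin n)} (hx : x ≠ 0) : (Δ u) x < 0 := by
  rw [h.laplacian_eq hpos hx, neg_lt_zero]
  exact mul_pos (h.convolution_pos hn hα0 hpos hx) (Real.rpow_pos_of_pos (hpos x hx) _)

/-- The nonlocal coefficient inherits the comparison with its conformal reflection. -/
theorem convolution_inversion_le [Nontrivial (EuclideanSpace ℝ (Fin n))] (hn : 3 ≤ n)
    (hα0 : 0 < α) (hαn : α < n) (h : IsHartreeSolution n α u)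
    (hpos : ∀ x : EuclideanSpace ℝ (Fin n), x ≠ 0 → 0 < u x)
    {c : EuclideanSpace ℝ (Fin n)} {l : ℝ} (hl : 0 < l) (hlc : l < ‖c‖)
    (hle : KelvinLE ((n : ℝ) - 2) c u l) {y : EuclideanSpace ℝ (Fin n)} (hy : y ≠ 0)
    (hly : l < ‖y - c‖) :
    (l / ‖y - c‖) ^ ((n : ℝ) - α) *
        (rieszKernel n α ⋆ (fun y => hartreeF n α (u y))) (inversion c l y) ≤
      (rieszKernel n α ⋆ (fun y => hartreeF n α (u y))) y := by
  have hp := critExp_pos hn hα0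
  rw [← ENNReal.ofReal_le_ofReal_iff (h.convolution_pos hn hα0 hpos hy).le,
    ENNReal.ofReal_mul (by positivity), h.ofReal_convolution hn hα0 hy,
    h.ofReal_convolution hn hα0 (inversion_ne_zero hl hlc hly.le)]
  refine lintegral_rpow_norm_inversion_le (by linarith) hl h.aemeasurable_hartreeF.ennreal_ofReal
    ?_ hly
  have hae : ∀ᵐ z : EuclideanSpace ℝ (Fin n), z ≠ 0 := by simp [ae_iff]
  filter_upwards [hae] with z hz hlz
  rw [finrank_euclideanSpace_fin, ← ENNReal.ofReal_mul (by positivity)]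
  refine ENNReal.ofReal_le_ofReal ?_
  have hT := hpos _ (inversion_ne_zero hl hlc hlz.le)
  -- Raising to the power `p` turns the weight `n - 2` into `(n - 2) p = n + α = 2 n - (n - α)`,
  -- exactly the one required for kernel exponent `n - α`.
  have h1 := Real.rpow_le_rpow (mul_nonneg (by positivity) hT.le) (hle z hz hlz.le) hp.le
  rw [Real.mul_rpow (by positivity) hT.le, ← Real.rpow_mul (by positivity),
    sub_two_mul_critExp hn] at h1
  rw [hartreeF, hartreeF, abs_of_pos hT, abs_of_pos (hpos z hz),
    show (2 * (n : ℝ) - (n - α)) = n + α by ring]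
  calc (l / ‖z - c‖) ^ ((n : ℝ) + α) * (critExp n α * u (inversion c l z) ^ critExp n α)
      = critExp n α * ((l / ‖z - c‖) ^ ((n : ℝ) + α) * u (inversion c l z) ^ critExp n α) := by
        ring
    _ ≤ critExp n α * u z ^ critExp n α := by gcongr

theorem laplacian_le_laplacian_kelvin [Nontrivial (EuclideanSpace ℝ (Fin n))] (hn : 3 ≤ n)
    (hα0 : 0 < α) (hαn : α < n) (h : IsHartreeSolution n α u)
    (hpos : ∀ x : EuclideanSpace ℝ (Fin n), x ≠ 0 → 0 < u x)
    {c : EuclideanSpace ℝ (Fin n)} {l : ℝ} (hl : 0 < l) (hlc : l < ‖c‖)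
    (hle : KelvinLE ((n : ℝ) - 2) c u l) {y : EuclideanSpace ℝ (Fin n)} (hy : y ≠ 0)
    (hly : l < ‖y - c‖) :
    (Δ u) y ≤ (Δ (kelvin ((n : ℝ) - 2) c l u)) y := by
  have hρ : 0 < ‖y - c‖ := hl.trans hly
  have hyc : y ≠ c := sub_ne_zero.1 (norm_pos_iff.1 hρ)
  have hT0 := inversion_ne_zero hl hlc hly.le
  have hT := hpos _ hT0
  have hp := one_lt_critExp hn hα0
  have hk : 0 < l / ‖y - c‖ := by positivity
  rw [laplacian_kelvin (by rw [finrank_euclideanSpace_fin]) hl hyc (h.contDiffAt hT0),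
    h.laplacian_eq hpos hy, h.laplacian_eq hpos hT0, mul_neg, neg_le_neg_iff]
  have h1 := h.convolution_inversion_le hn hα0 hαn hpos hl hlc hle hy hly
  have h2 := Real.rpow_le_rpow (mul_nonneg (by positivity) hT.le) (hle y hy hly.le)
    (by linarith : 0 ≤ critExp n α - 1)
  rw [Real.mul_rpow (by positivity) hT.le, ← Real.rpow_mul hk.le] at h2
  refine le_trans (le_of_eq ?_) (mul_le_mul h1 h2 (by positivity)
    (h.convolution_pos hn hα0 hpos hy).le)
  -- Criticality again: both sides have exponent `n + 2`, since `(n - 2) (p - 1) = α + 2`.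
  have h3 : (l / ‖y - c‖) ^ ((n : ℝ) - 2) * (l / ‖y - c‖) ^ 4 =
      (l / ‖y - c‖) ^ ((n : ℝ) - α) * (l / ‖y - c‖) ^ (((n : ℝ) - 2) * (critExp n α - 1)) := by
    rw [← Real.rpow_natCast, ← Real.rpow_add hk, ← Real.rpow_add hk, mul_sub,
      sub_two_mul_critExp hn]
    congr 1; push_cast; ring
  rw [h3]; ring

/-- Singular positive solutions dominate their Kelvin transforms in all spheres that do not enclose
the origin. -/
theorem kelvinLE [Nontrivial (EuclideanSpace ℝ (Fin n))] (hn : 3 ≤ n) (hα0 : 0 < α) (hαn : α < n)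
    (h : IsHartreeSolution n α u) (hpos : ∀ x : EuclideanSpace ℝ (Fin n), x ≠ 0 → 0 < u x)
    (hsing : IsSingularAtZero u) (c : EuclideanSpace ℝ (Fin n)) (l : ℝ) (hl : 0 < l)
    (hlc : l < ‖c‖) : KelvinLE ((n : ℝ) - 2) c u l := by
  have hn' : (3 : ℝ) ≤ n := by exact_mod_cast hn
  have hs : 0 < (n : ℝ) - 2 := by linarith
  have hsd : (n : ℝ) - 2 = Module.finrank ℝ (EuclideanSpace ℝ (Fin n)) - 2 := by
    rw [finrank_euclideanSpace_fin]
  have hc : c ≠ 0 := norm_pos_iff.1 (hl.trans hlc)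
  exact kelvinLE_of_continuation hs (fun y hy => (h.contDiffAt hy).continuousAt)
    (exists_kelvinLE_near_zero hs hsd (fun y hy => h.contDiffAt hy) hpos
      (fun y hy => (h.laplacian_neg hn hα0 hpos hy).le) hsing.eventually_gt hc)
    (fun l hl hlc hle => exists_kelvinLE_gt_of_laplacian_le hs hsd (fun y hy => h.contDiffAt hy)
      hsing.eventually_gt hl hlc hle
      fun y hy hly => h.laplacian_le_laplacian_kelvin hn hα0 hαn hpos hl hlc hle hy hly)
    l hl hlc

end IsHartreeSolution

end Hartree

/-- Singular positive solutions of the critical Hartree equation are radial and decreasing. The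
convergence of the convolution already contains the local integrability `hLp`, so the proof by
moving spheres does not refer to it separately. -/
theorem theorem1p1 (n : ℕ) (hn : 3 ≤ n) (α : ℝ) (hα0 : 0 < α) (hαn : α < (n : ℝ))
    (u : EuclideanSpace ℝ (Fin n) → ℝ)
    (hpos : ∀ x : EuclideanSpace ℝ (Fin n), x ≠ 0 → 0 < u x)
    (hsol : IsHartreeSolution n α u)
    (hLp : MemLpLoc u (critExp n α))
    (hsing : IsSingularAtZero u) :
    ∃ w : ℝ → ℝ, StrictAntiOn w (Set.Ioi 0) ∧
      ∀ x : EuclideanSpace ℝ (Fin n), x ≠ 0 → u x = w ‖x‖ := by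
  have : Nontrivial (EuclideanSpace ℝ (Fin n)) := Module.nontrivial_of_finrank_pos (R := ℝ)
    (by rw [finrank_euclideanSpace_fin]; omega)
  have hmono : ∀ y z : EuclideanSpace ℝ (Fin n), y ≠ 0 → z ≠ 0 → ‖y‖ ≤ ‖z‖ → u z ≤ u y :=
    fun y z hy hz => le_of_norm_le_of_kelvinLE (fun y hy => (hsol.contDiffAt hy).continuousAt)
      (hsol.kelvinLE hn hα0 hαn hpos hsing) hy hz
  obtain ⟨e, he⟩ := exists_norm_eq (EuclideanSpace ℝ (Fin n)) zero_le_one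
  have hnorm : ∀ t : ℝ, 0 < t → ‖t • e‖ = t := fun t ht => by
    rw [norm_smul, he, mul_one, Real.norm_of_nonneg ht.le]
  have hne : ∀ t : ℝ, 0 < t → t • e ≠ 0 := fun t ht =>
    norm_pos_iff.1 (by rw [hnorm t ht]; exact ht)
  refine ⟨fun t => u (t • e), fun a ha b hb hab => ?_, fun x hx => ?_⟩
  · have ha' : 0 < a := ha
    have hb' : 0 < b := hb
    have hab' : a < b := hab
    refine lt_of_le_of_ne (hmono _ _ (hne a ha') (hne b hb') (by
      rw [hnorm a ha', hnorm b hb']; exact hab'.le)) fun heq => ?_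
    have hm : 0 < (a + b) / 2 := by linarith
    -- Equal values at radii `a` and `b` force `u` to be constant on the annulus between them, so `Δ
    -- u = 0` there, against `Δ u < 0`.
    have hconst : u =ᶠ[𝓝 (((a + b) / 2) • e)] fun _ => u (a • e) := by
      have hc : Tendsto (fun x : EuclideanSpace ℝ (Fin n) => ‖x‖) (𝓝 (((a + b) / 2) • e))
          (𝓝 ((a + b) / 2)) := by
        have := (continuous_norm (E := EuclideanSpace ℝ (Fin n))).tendsto (((a + b) / 2) • e)
        rwa [hnorm _ hm] at this
      filter_upwards [hc.eventually (Ioo_mem_nhds (by linarith : a < (a + b) / 2)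
        (by linarith : (a + b) / 2 < b))] with x hx
      have hx0 : x ≠ 0 := norm_pos_iff.1 (ha'.trans hx.1)
      have h1 := hmono (a • e) x (hne a ha') hx0 (by rw [hnorm a ha']; exact hx.1.le)
      have h2 := hmono x (b • e) hx0 (hne b hb') (by rw [hnorm b hb']; exact hx.2.le)
      exact le_antisymm h1 ((show u (a • e) = u (b • e) from heq.symm).trans_le h2)
    have h0 := (InnerProductSpace.laplacian_congr_nhds hconst).self_of_nhds
    have h1 := hsol.laplacian_neg hn hα0 hpos (hne _ hm)
    rw [h0] at h1
    simp at h1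
  · have hx' : 0 < ‖x‖ := norm_pos_iff.2 hx
    exact le_antisymm (hmono _ _ (hne _ hx') hx (hnorm _ hx').le)
      (hmono _ _ hx (hne _ hx') (hnorm _ hx').ge)
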